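/- Let $(R,\mathfrak m)$ be a commutative Noetherian local ring, let $I$ be an $\mathfrak m$-primary ideal of $R$, and let $M\neq 0$ and $N$ be finitely generated $R$-modules. For a finitely generated module $X\ne 0$ of dimension $d$ put $$e_R(I,X)=d!\,\lim_{n\to\infty}\frac{\ell_R(X/I^nX)}{n^{d}},$$ let $\operatorname{Assh}_R(X)=\{\mathfrak p\in\operatorname{Ass}_R(X):\dim(R/\mathfrak p)=\dim_R(X)\}$, and call $X$ unmixed if $\operatorname{Ass}_R(X)=\operatorname{Assh}_R(X)$. Say that a module $X$ has rank $r$ (an integer $r\ge 0$) if $X_{\mathfrak p}\cong R_{\mathfrak p}^{\oplus r}$ for every $\mathfrak p\in\operatorname{Ass}(R)$, that $X$ has rank if this holds for some $r\geq 0$, and that it has positive rank if this holds for some $r>0$. Assume that $M/IM$ and $N/IN$ are both free over $R/I$, that $M\otimes_R N$ is Cohen-Macaulay, that $\dim_R(M)=\dim_R(M\otimes_R N)$, and that $e_R(I,M)=\ell_R(M/IM)$. Then $N$ is free if at least one of the following holds: (i) $N$ has rank, and $\operatorname{Tor}_1^R(M,N)_{\mathfrak p}=0$ for some $\mathfrak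 p\in\operatorname{Assh}_R(M)$. (ii) $M$ is unmixed and at least one of the following holds: (a) $M$ is faithful; (b) $\operatorname{Tor}_1^R(M,N)=0$; (c) $\operatorname{Tor}_1^R(M,N)$ is torsion and $\operatorname{Supp}_R(M)=\operatorname{Spec}(R)$. (iii) $M$ has positive rank, and $R$ is unmixed (as a module over itself). -/

import Mathlib

open scoped TensorProduct Nat
open Filter Topology CategoryTheory

universe u

namespace UlrichMod

/-- `I` is an `𝔪`-primary ideal of the local ring `R`. -/
def IsMaximalPrimary (R : Type*) [CommRing R] [IsLocalRing R] (I : Ideal R) : Prop :=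
  I.radical = IsLocalRing.maximalIdeal R

/-- The Krull dimension of a module as a natural number. For a nonzero finitely generated module
over a Noetherian local ring the dimension is finite and this is its value; the zero module
(of dimension `⊥`) gets the value `0`. -/
noncomputable def natDim (R : Type*) [CommRing R] (M : Type*) [AddCommGroup M] [Module R M] : ℕ :=
  ((Module.supportDim R M).unbotD 0).toNat

/-- The length of `M / I M` as a natural number (it is finite when `I` is `𝔪`-primary and `M` is
finitely generated over a Noetherian local ring). -/
noncomputable def colength (R : Type*) [CommRing R] (I : Ideal R)
    (M : Type*) [AddCommGroup M] [Module R M] : ℕ :=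
  (Module.length R (M ⧸ (I • (⊤ : Submodule R M)))).toNat

/-- The Hilbert-Samuel multiplicity of `M` with respect to `I` is `e`, that is,
`e = d! * lim ℓ(M / I ^ n M) / n ^ d` as `n → ∞`, where `d = dim M`. -/
def HasMultiplicity (R : Type*) [CommRing R] (I : Ideal R)
    (M : Type*) [AddCommGroup M] [Module R M] (e : ℝ) : Prop :=
  Tendsto (fun n : ℕ => ((natDim R M)! : ℝ) * ((colength R (I ^ n) M : ℝ) / (n : ℝ) ^ natDim R M))
    atTop (𝓝 e)

/-- The depth of a module over a local ring: the supremum of the lengths of `M`-regular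
sequences contained in the maximal ideal. -/
noncomputable def depth (R : Type*) [CommRing R] [IsLocalRing R]
    (M : Type*) [AddCommGroup M] [Module R M] : ℕ∞ :=
  sSup {n : ℕ∞ | ∃ rs : List R, (∀ r ∈ rs, r ∈ IsLocalRing.maximalIdeal R) ∧
    RingTheory.Sequence.IsRegular M rs ∧ n = (rs.length : ℕ∞)}

/-- A (finitely generated) module over a (Noetherian) local ring is Cohen-Macaulay if it is zero
or its depth equals its dimension. -/
def IsCohenMacaulay (R : Type*) [CommRing R] [IsLocalRing R]
    (M : Type*) [AddCommGroup M] [Module R M] : Prop :=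
  Subsingleton M ∨ ((depth R M : ℕ∞) : WithBot ℕ∞) = Module.supportDim R M

/-- `M` has rank `r`: `M_𝔭` is free of rank `r` over `R_𝔭` for every `𝔭 ∈ Ass(R)`. -/
def HasRank (R : Type*) [CommRing R] (M : Type*) [AddCommGroup M] [Module R M] (r : ℕ) : Prop :=
  ∀ (p : Ideal R) [p.IsPrime], p ∈ associatedPrimes R R →
    Nonempty (LocalizedModule p.primeCompl M ≃ₗ[Localization.AtPrime p]
      (Fin r → Localization.AtPrime p))

/-- `Assh(M)`: the associated primes `𝔭` of `M` with `dim (R / 𝔭) = dim M`. -/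
def assh (R : Type*) [CommRing R] (M : Type*) [AddCommGroup M] [Module R M] : Set (Ideal R) :=
  {p | p ∈ associatedPrimes R M ∧ ringKrullDim (R ⧸ p) = Module.supportDim R M}

/-- `M` is unmixed if `Ass(M) = Assh(M)`. -/
def IsUnmixed (R : Type*) [CommRing R] (M : Type*) [AddCommGroup M] [Module R M] : Prop :=
  associatedPrimes R M = assh R M

/-- The module `Tor₁(M, N)`. -/
noncomputable abbrev Tor1 (R : Type u) [CommRing R] (M N : Type u) [AddCommGroup M] [Module R M]
    [AddCommGroup N] [Module R N] : ModuleCat.{u} R :=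
  ((Tor (ModuleCat.{u} R) 1).obj (ModuleCat.of R M)).obj (ModuleCat.of R N)

end UlrichMod

/-!
Choose a presentation `0 → L → R ^ n → N → 0` in which `n` is the rank of `N / I N`. Since `N / I N`
is free over `R / I`, `L ≤ I R ^ n`, so that `(M ⊗ N) / I (M ⊗ N) ≅ (M / I M) ^ n`. Put `d = dim M`.

For a Cohen-Macaulay module `X` of dimension `d` the multiplicity is at least the colength:
`ℓ(X / I X) * (k + d).choose d ≤ ℓ(X / I ^ (k + K) X)` for a constant `K`
(`exists_length_mul_choose_le`). It is proved by induction on `d`. When the residue field is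
infinite one would divide by a general element of `I`. Here the residue field is arbitrary, and the
general element is taken with indeterminate coefficients, over the localization of `R[t]` at
`𝔪 R[t]`. The Dedekind-Mertens lemma reduces the colon ideals of the generic element to colons by
`I` itself, and these are handled by the finiteness of the Ratliff-Rush filtration.

Apply this to `X = M ⊗ N`. The kernel `W` of `M ⊗ R ^ n → M ⊗ N` fits into
`0 → W → M ^ n → M ⊗ N → 0`, and the multiplicity of `M ^ n` is `n * e(I, M) = n * ℓ(M / I M)`,
which is `ℓ((M ⊗ N) / I (M ⊗ N))`. There is no multiplicity left for `W`, so `dim W < d`: `W`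
vanishes at every prime `q` with `dim R / q = d` (`exists_smul_eq_zero_of_mem_ker_lTensor`). This
argument uses only binomial lower bounds and never the existence of a Hilbert polynomial.

It remains to deduce `L = 0`, for which it is enough that `L` vanishes at the associated primes
of `R`.

* Suppose that `N` has rank and that `Tor₁(M, N)` vanishes at a component `q` of `M` of dimension
  `d`. Then `(M ⊗ L)_q`, an extension of a submodule of `W_q` by a quotient of `Tor₁(M, N)_q`, is
  zero, hence `L_q = 0`. So the rank of `N` is `n`, and `R ^ n → N` is injective at every associated
  prime of `R` (`free_of_hasRank`).
* Suppose that `M` is unmixed. Then `W = 0`, since `W` is a submodule of `M ^ n`. If `M` is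
  faithful, then `L = 0` because `m ⊗ l` maps into `W`; otherwise `M ⊗ L` is a quotient of
  `Tor₁(M, N)`, and one looks at its support (`free_of_lTensor_injective`).
* Suppose that `M` has positive rank and that `R` is unmixed. Then every associated prime `q` of `R`
  satisfies `dim R / q = d`, and `M_q` has a nonzero free direct summand, so `W_q = 0` gives
  `L_q = 0` (`free_of_hasRank_of_isUnmixed_self`).
-/

/-! ### Lengths and linear maps -/

section Length

variable {R : Type*} [CommRing R] {X Y Z W : Type*} [AddCommGroup X] [Module R X]
  [AddCommGroup Y] [Module R Y] [AddCommGroup Z] [Module R Z] [AddCommGroup W] [Module R W]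

theorem map_smul_top_eq_of_surjective (J : Ideal R) (f : Y →ₗ[R] W) (hf : Function.Surjective f) :
    (J • (⊤ : Submodule R Y)).map f = J • ⊤ := by
  rw [Submodule.map_smul'', Submodule.map_top, LinearMap.range_eq_top.mpr hf]

theorem apply_mem_smul_top (J : Ideal R) (f : Y →ₗ[R] W) {y : Y}
    (hy : y ∈ J • (⊤ : Submodule R Y)) : f y ∈ J • (⊤ : Submodule R W) := by
  have h := Submodule.mem_map_of_mem (f := f) hy
  rw [Submodule.map_smul''] at h
  exact Submodule.smul_mono le_rfl le_top h

theorem length_quotient_smul_le_of_surjective (J : Ideal R) (f : Y →ₗ[R] W)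
    (hf : Function.Surjective f) :
    Module.length R (W ⧸ J • (⊤ : Submodule R W)) ≤
      Module.length R (Y ⧸ J • (⊤ : Submodule R Y)) := by
  have h : J • (⊤ : Submodule R Y) ≤ (J • (⊤ : Submodule R W)).comap f := by
    rw [← Submodule.map_le_iff_le_comap, map_smul_top_eq_of_surjective J f hf]
  refine Module.length_le_of_surjective (Submodule.mapQ _ _ f h) ?_
  intro w
  obtain ⟨w, rfl⟩ := Submodule.mkQ_surjective _ w
  obtain ⟨y, rfl⟩ := hf w
  exact ⟨Submodule.mkQ _ y, rfl⟩

theorem length_quotient_smul_le_of_ker_le {J : Ideal R} (f : Y →ₗ[R] W)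
    (hf : Function.Surjective f) (hker : LinearMap.ker f ≤ J • ⊤) :
    Module.length R (Y ⧸ J • (⊤ : Submodule R Y)) ≤
      Module.length R (W ⧸ J • (⊤ : Submodule R W)) := by
  have h : (J • (⊤ : Submodule R W)).comap f = J • ⊤ := by
    rw [← map_smul_top_eq_of_surjective J f hf, Submodule.comap_map_eq, sup_eq_left.mpr hker]
  refine Module.length_le_of_injective (Submodule.mapQ _ _ f h.ge) ?_
  rw [← LinearMap.ker_eq_bot, Submodule.ker_mapQ, h, ← le_bot_iff,
    Submodule.map_le_iff_le_comap, Submodule.comap_bot, Submodule.ker_mkQ]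

theorem length_quotient_smul_anti {J J' : Ideal R} (h : J ≤ J') :
    Module.length R (Y ⧸ J' • (⊤ : Submodule R Y)) ≤
      Module.length R (Y ⧸ J • (⊤ : Submodule R Y)) :=
  Module.length_le_of_surjective (Submodule.factor (Submodule.smul_mono_left h))
    (Submodule.factor_surjective _)

theorem length_quotient_pow_smul_monotone (I : Ideal R) :
    Monotone fun n : ℕ ↦ Module.length R (Y ⧸ I ^ n • (⊤ : Submodule R Y)) :=
  fun _ _ h ↦ length_quotient_smul_anti (Ideal.pow_le_pow_right h)

theorem length_quotient_smul_congr (J : Ideal R) (e : Y ≃ₗ[R] W) :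
    Module.length R (Y ⧸ J • (⊤ : Submodule R Y)) =
      Module.length R (W ⧸ J • (⊤ : Submodule R W)) :=
  le_antisymm (length_quotient_smul_le_of_surjective J e.symm.toLinearMap e.symm.surjective)
    (length_quotient_smul_le_of_surjective J e.toLinearMap e.surjective)

/-- A complex `Z → Y → W → 0` gives a lower bound for the length of `Y / J Y`. The hypothesis
`h` replaces the injectivity of `Z / J' Z → Y / J Y`. -/
theorem length_add_length_le (J J' : Ideal R) (u : Z →ₗ[R] Y) (v : Y →ₗ[R] W)
    (hv : Function.Surjective v) (huv : v ∘ₗ u = 0)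
    (h : ∀ z, u z ∈ J • (⊤ : Submodule R Y) → z ∈ J' • (⊤ : Submodule R Z)) :
    Module.length R (Z ⧸ J' • (⊤ : Submodule R Z)) +
      Module.length R (W ⧸ J • (⊤ : Submodule R W)) ≤
        Module.length R (Y ⧸ J • (⊤ : Submodule R Y)) := by
  set A : Submodule R Y := J • ⊤
  let g : Z →ₗ[R] Y ⧸ A := A.mkQ ∘ₗ u
  have hker : LinearMap.ker g ≤ J' • ⊤ := by
    intro z hz
    refine h z ?_
    simpa [g] using hz
  have hA : A ≤ (J • (⊤ : Submodule R W)).comap v := by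
    rw [← Submodule.map_le_iff_le_comap, map_smul_top_eq_of_surjective J v hv]
  rw [Module.length_eq_add_of_exact (LinearMap.range g).subtype (LinearMap.range g).mkQ
    (Submodule.subtype_injective _) (Submodule.mkQ_surjective _)
    (LinearMap.exact_subtype_mkQ _)]
  refine add_le_add ?_ ?_
  · rw [← (g.quotKerEquivRange).length_eq]
    exact Module.length_le_of_surjective (Submodule.factor hker) (Submodule.factor_surjective _)
  · have hr : LinearMap.range g ≤ LinearMap.ker (Submodule.mapQ A _ v hA) := by
      rintro _ ⟨z, rfl⟩
      have : v (u z) = 0 := LinearMap.congr_fun huv z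
      simp [g, this]
    refine Module.length_le_of_surjective (Submodule.liftQ _ _ hr) ?_
    intro w
    obtain ⟨w, rfl⟩ := Submodule.mkQ_surjective _ w
    obtain ⟨y, rfl⟩ := hv w
    exact ⟨Submodule.mkQ _ (A.mkQ y), rfl⟩

/-- The Artin-Rees lemma, stated for an injective map. -/
theorem exists_mem_pow_smul_of_injective [IsNoetherianRing R] [Module.Finite R Y] (I : Ideal R)
    (u : Z →ₗ[R] Y) (hu : Function.Injective u) :
    ∃ c : ℕ, ∀ n z, u z ∈ I ^ (n + c) • (⊤ : Submodule R Y) →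
      z ∈ I ^ n • (⊤ : Submodule R Z) := by
  obtain ⟨c, hc⟩ := I.exists_pow_inf_eq_pow_smul (LinearMap.range u)
  refine ⟨c, fun n z hz ↦ ?_⟩
  have h1 : u z ∈ I ^ (n + c) • (⊤ : Submodule R Y) ⊓ LinearMap.range u := ⟨hz, z, rfl⟩
  rw [hc _ (Nat.le_add_left _ _), Nat.add_sub_cancel] at h1
  have h2 : u z ∈ I ^ n • LinearMap.range u :=
    (smul_mono_right _ inf_le_right : _ ≤ I ^ n • LinearMap.range u) h1
  rw [← Submodule.map_top, ← Submodule.map_smul''] at h2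
  obtain ⟨z', hz', h⟩ := h2
  rwa [← hu h]

theorem length_pi_quotient_smul (J : Ideal R) (n : ℕ) :
    Module.length R ((Fin n → Y) ⧸ J • (⊤ : Submodule R (Fin n → Y))) =
      n * Module.length R (Y ⧸ J • (⊤ : Submodule R Y)) := by
  let f : (Fin n → Y) →ₗ[R] (Fin n → Y ⧸ J • (⊤ : Submodule R Y)) :=
    LinearMap.pi fun i ↦ Submodule.mkQ _ ∘ₗ LinearMap.proj i
  have hf : Function.Surjective f := by
    intro z
    choose y hy using fun i ↦ Submodule.mkQ_surjective _ (z i)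
    exact ⟨y, funext hy⟩
  have hker : LinearMap.ker f = J • ⊤ := by
    apply le_antisymm
    · intro z hz
      have hz' : ∀ i, z i ∈ J • (⊤ : Submodule R Y) := fun i ↦
        (Submodule.Quotient.mk_eq_zero _).mp (congrFun hz i)
      rw [← Finset.univ_sum_single z]
      exact Submodule.sum_mem _ fun i _ ↦
        apply_mem_smul_top J (LinearMap.single R (fun _ : Fin n ↦ Y) i) (hz' i)
    · intro z hz
      exact funext fun i ↦ (Submodule.Quotient.mk_eq_zero _).mpr
        (apply_mem_smul_top J (LinearMap.proj i : (Fin n → Y) →ₗ[R] Y) hz)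
  rw [← hker, (f.quotKerEquivOfSurjective hf).length_eq, Module.length_pi]
  simp

end Length

/-! ### Growth of sequences -/

/-- Summation of a lower bound of degree `d` for the differences of a sequence gives a lower bound
of degree `d + 1`. -/
theorem exists_mul_choose_le_of_add_le {a b : ℕ → ℕ∞} (ha : Monotone a) (hb : Monotone b)
    {L : ℕ∞} {d m c K₀ K₁ n₀ : ℕ} (hm : 0 < m) (hc : 0 < c) (haK : L ≤ a K₀)
    (hbK : ∀ k : ℕ, L * ((k + d).choose d : ℕ) ≤ b (m * k + K₁))
    (hab : ∀ n, n₀ ≤ n → a n + b (n + c) ≤ a (n + c)) :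
    ∃ K : ℕ, ∀ k : ℕ, L * ((k + (d + 1)).choose (d + 1) : ℕ) ≤ a (m * c * k + K) := by
  refine ⟨K₀ + K₁ + n₀, fun k ↦ ?_⟩
  induction k with
  | zero => simpa using haK.trans (ha (by lia))
  | succ k ih =>
    have e : k + 1 + (d + 1) = (k + 1 + d) + 1 := by lia
    obtain ⟨m, rfl⟩ := Nat.exists_eq_succ_of_ne_zero hm.ne'
    rw [e, Nat.choose_succ_succ, add_comm, Nat.cast_add, mul_add]
    have h1 := hab ((m + 1) * c * k + (K₀ + K₁ + n₀) + m * c) (by lia)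
    have e2 : (m + 1) * c * k + (K₀ + K₁ + n₀) + m * c + c =
      (m + 1) * c * (k + 1) + (K₀ + K₁ + n₀) := by ring
    rw [e2] at h1
    refine le_trans (add_le_add ?_ ?_) h1
    · have e3 : k + 1 + d = k + (d + 1) := by lia
      rw [e3]
      exact ih.trans (ha (by lia))
    · refine (hbK (k + 1)).trans (hb ?_)
      have : (m + 1) * (k + 1) ≤ (m + 1) * c * (k + 1) := by
        rw [mul_assoc]
        exact Nat.mul_le_mul_left _ (Nat.le_mul_of_pos_left _ hc)
      simp only [Nat.succ_eq_add_one]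
      lia

/-! ### Lower bound for the Hilbert-Samuel function in terms of the dimension -/

section Dimension

variable {R : Type*} [CommRing R] [IsLocalRing R]

theorem one_le_length_quotient_smul {Y : Type*} [AddCommGroup Y] [Module R Y] [Module.Finite R Y]
    [Nontrivial Y] {J : Ideal R} (hJ : J ≤ IsLocalRing.maximalIdeal R) :
    1 ≤ Module.length R (Y ⧸ J • (⊤ : Submodule R Y)) := by
  rw [Order.one_le_iff_pos, Module.length_pos_iff, Submodule.Quotient.nontrivial_iff]
  intro h
  have := Submodule.eq_bot_of_le_smul_of_le_jacobson_bot J (⊤ : Submodule R Y)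
    Module.Finite.fg_top h.ge (hJ.trans (IsLocalRing.maximalIdeal_le_jacobson _))
  exact top_ne_bot this

/-- For a chain of primes `p ⊆ p₀ < ⋯ < p_d` the function `n ↦ ℓ(R / (p + I ^ n))` grows at
least like a polynomial of degree `d`. -/
theorem exists_choose_le_length_of_ltSeries [IsNoetherianRing R] {I : Ideal R}
    (hI : I ≤ IsLocalRing.maximalIdeal R) (d : ℕ) (s : LTSeries (PrimeSpectrum R))
    (hs : s.length = d) (p : Ideal R) [p.IsPrime] (hp : p ≤ s.head.asIdeal) :
    ∃ m K : ℕ, 0 < m ∧ ∀ k : ℕ, (((k + d).choose d : ℕ) : ℕ∞) ≤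
      Module.length R ((R ⧸ p) ⧸ I ^ (m * k + K) • (⊤ : Submodule R (R ⧸ p))) := by
  induction d generalizing s p with
  | zero =>
    refine ⟨1, 1, one_pos, fun k ↦ ?_⟩
    simpa using one_le_length_quotient_smul (Y := R ⧸ p)
      ((Ideal.pow_le_self (I := I) (Nat.succ_ne_zero (1 * k))).trans hI)
  | succ d ih =>
    have hlen : s.length ≠ 0 := by lia
    have h01 : s.head < (s.tail hlen).head := by
      rw [RelSeries.head_tail]
      exact s.strictMono (Fin.lt_def.mpr
        (by simp [Nat.mod_eq_of_lt (show 1 < s.length + 1 by lia)]) :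
          (0 : Fin (s.length + 1)) < 1)
    set P := (s.tail hlen).head.asIdeal
    obtain ⟨m, K, hm, hmK⟩ := ih (s.tail hlen) (by simp [hs]) P le_rfl
    have hpP : p < P := lt_of_le_of_lt hp h01
    obtain ⟨x, hxP, hxp⟩ := SetLike.exists_of_lt hpP
    let u : (R ⧸ p) →ₗ[R] (R ⧸ p) := LinearMap.lsmul R (R ⧸ p) x
    let v : (R ⧸ p) →ₗ[R] (R ⧸ P) := Submodule.factor hpP.le
    have hv : Function.Surjective v := Submodule.factor_surjective _
    have hu : Function.Injective u := by
      rw [injective_iff_map_eq_zero]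
      intro y hy
      obtain ⟨y, rfl⟩ := Ideal.Quotient.mk_surjective y
      have hy' : Ideal.Quotient.mk p (x * y) = 0 := hy
      rw [Ideal.Quotient.eq_zero_iff_mem] at hy' ⊢
      exact (‹p.IsPrime›.mem_or_mem hy').resolve_left hxp
    have huv : v ∘ₗ u = 0 := by
      ext
      simp only [u, v, LinearMap.comp_apply, LinearMap.lsmul_apply, map_smul]
      change Ideal.Quotient.mk P (x * 1) = 0
      rw [mul_one, Ideal.Quotient.eq_zero_iff_mem]
      exact hxP
    obtain ⟨c, hc⟩ := exists_mem_pow_smul_of_injective I u hu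
    have key : ∀ n, 0 ≤ n → Module.length R ((R ⧸ p) ⧸ I ^ n • (⊤ : Submodule R (R ⧸ p))) +
        Module.length R ((R ⧸ P) ⧸ I ^ (n + (c + 1)) • (⊤ : Submodule R (R ⧸ P))) ≤
        Module.length R ((R ⧸ p) ⧸ I ^ (n + (c + 1)) • (⊤ : Submodule R (R ⧸ p))) := by
      intro n _
      refine length_add_length_le _ _ u v hv huv fun z hz ↦ hc n z ?_
      exact Submodule.smul_mono_left (Ideal.pow_le_pow_right (by lia)) hz
    obtain ⟨K', hK'⟩ := exists_mul_choose_le_of_add_le (L := 1) (d := d) (K₀ := 1) (n₀ := 0)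
      (length_quotient_pow_smul_monotone (Y := R ⧸ p) I)
      (length_quotient_pow_smul_monotone (Y := R ⧸ P) I) hm (Nat.succ_pos c)
      (one_le_length_quotient_smul ((pow_one I).le.trans hI)) (by simpa using hmK) key
    exact ⟨m * (c + 1), K', by positivity, by simpa using hK'⟩

theorem exists_choose_le_length_of_le_ringKrullDim [IsNoetherianRing R] {I : Ideal R}
    (hI : I ≤ IsLocalRing.maximalIdeal R) {d : ℕ} (p : Ideal R) [p.IsPrime]
    (hp : d ≤ ringKrullDim (R ⧸ p)) :
    ∃ m K : ℕ, 0 < m ∧ ∀ k : ℕ, (((k + d).choose d : ℕ) : ℕ∞) ≤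
      Module.length R ((R ⧸ p) ⧸ I ^ (m * k + K) • (⊤ : Submodule R (R ⧸ p))) := by
  rw [ringKrullDim_quotient, Order.le_krullDim_iff] at hp
  obtain ⟨s, hs⟩ := hp
  refine exists_choose_le_length_of_ltSeries hI d
    (s.map (fun q ↦ (q : PrimeSpectrum R)) fun _ _ h ↦ h) hs p ?_
  exact s.head.2

end Dimension

/-! ### The Dedekind-Mertens lemma with module coefficients -/

section Content

open Polynomial

variable {R X : Type*} [CommRing R] [AddCommGroup X] [Module R X]

/-- The ideal generated by the coefficients of a polynomial. -/
def coeffIdeal (f : R[X]) : Ideal R := Ideal.span (Set.range f.coeff)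

/-- The submodule generated by the coefficients of a polynomial with module coefficients. -/
def coeffSpan (g : PolynomialModule R X) : Submodule R X := Submodule.span R (Set.range g.coeff)

theorem coeff_mem_coeffIdeal (f : R[X]) (n : ℕ) : f.coeff n ∈ coeffIdeal f :=
  Ideal.subset_span ⟨n, rfl⟩

theorem coeff_mem_coeffSpan (g : PolynomialModule R X) (n : ℕ) : g.coeff n ∈ coeffSpan g :=
  Submodule.subset_span ⟨n, rfl⟩

theorem coeffSpan_le_iff {g : PolynomialModule R X} {H : Submodule R X} :
    coeffSpan g ≤ H ↔ ∀ n, g.coeff n ∈ H := by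
  rw [coeffSpan, Submodule.span_le]
  exact Set.range_subset_iff

theorem coeffSpan_smul (r : R) (g : PolynomialModule R X) :
    coeffSpan (r • g) = Ideal.span {r} • coeffSpan g := by
  rw [coeffSpan, coeffSpan, Submodule.span_smul_span, Set.singleton_smul]
  congr 1
  ext x
  constructor
  · rintro ⟨n, rfl⟩
    exact ⟨_, ⟨n, rfl⟩, rfl⟩
  · rintro ⟨_, ⟨n, rfl⟩, rfl⟩
    exact ⟨n, rfl⟩

theorem coeffIdeal_eq_sup (f : R[X]) :
    coeffIdeal f = Ideal.span {f.coeff 0} ⊔ coeffIdeal f.divX := by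
  apply le_antisymm
  · rw [coeffIdeal, Ideal.span_le]
    rintro _ ⟨n, rfl⟩
    cases n with
    | zero => exact Ideal.mem_sup_left (Ideal.mem_span_singleton_self _)
    | succ n =>
      rw [← coeff_divX]
      exact Ideal.mem_sup_right (coeff_mem_coeffIdeal _ _)
  · refine sup_le ?_ ?_
    · rw [Ideal.span_singleton_le_iff_mem]
      exact coeff_mem_coeffIdeal f 0
    · rw [coeffIdeal, Ideal.span_le]
      rintro _ ⟨n, rfl⟩
      rw [coeff_divX]
      exact coeff_mem_coeffIdeal f _

theorem Ideal.sup_pow_succ_le (A B : Ideal R) (n : ℕ) :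
    (A ⊔ B) ^ (n + 1) ≤ A * (A ⊔ B) ^ n ⊔ B ^ (n + 1) := by
  induction n with
  | zero => simp
  | succ n ih =>
    calc (A ⊔ B) ^ (n + 2) = (A ⊔ B) * (A ⊔ B) ^ (n + 1) := pow_succ' _ _
      _ = A * (A ⊔ B) ^ (n + 1) ⊔ B * (A ⊔ B) ^ (n + 1) := Ideal.sup_mul _ _ _
      _ ≤ A * (A ⊔ B) ^ (n + 1) ⊔ B * (A * (A ⊔ B) ^ n ⊔ B ^ (n + 1)) :=
          sup_le_sup_left (Ideal.mul_mono_right ih) _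
      _ ≤ A * (A ⊔ B) ^ (n + 1) ⊔ B ^ (n + 2) := by
          rw [Ideal.mul_sup, ← pow_succ' B]
          refine sup_le le_sup_left (sup_le (le_sup_of_le_left ?_) le_sup_right)
          rw [mul_left_comm, pow_succ' (A ⊔ B)]
          exact Ideal.mul_mono_right (Ideal.mul_mono_left le_sup_right)

/-- Powers of the constant coefficient of `f` move the coefficients of `g` into the span of those
of `f • g`. -/
theorem pow_succ_smul_coeff_mem {f : R[X]} {g : PolynomialModule R X} {H : Submodule R X}
    (h : ∀ n, (f • g).coeff n ∈ H) (n : ℕ) :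
    f.coeff 0 ^ (n + 1) • g.coeff n ∈ coeffIdeal f ^ n • H := by
  induction n using Nat.strong_induction_on with
  | _ n ih =>
    have h0 : f.coeff 0 ∈ coeffIdeal f := coeff_mem_coeffIdeal f 0
    have hn := h n
    rw [PolynomialModule.smul_apply, Finset.Nat.antidiagonal_eq_map, Finset.sum_map,
      Finset.sum_range_succ'] at hn
    have h1 := Submodule.smul_mem_smul (Ideal.pow_mem_pow h0 n) hn
    rw [smul_add] at h1
    have h2 : f.coeff 0 ^ (n + 1) • g.coeff n =
        f.coeff 0 ^ n • f.coeff 0 • g.coeff n := by rw [pow_succ, mul_smul]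
    rw [h2]
    refine (Submodule.add_mem_iff_right _ ?_).mp h1
    rw [Finset.smul_sum]
    refine Submodule.sum_mem _ fun i hi ↦ ?_
    rw [Finset.mem_range] at hi
    have h3 := Submodule.smul_mem_smul (Ideal.mul_mem_mul (coeff_mem_coeffIdeal f (i + 1))
      (Ideal.pow_mem_pow h0 i)) (ih (n - (i + 1)) (by lia))
    rw [← Submodule.mul_smul, smul_smul] at h3
    have e1 : coeffIdeal f * coeffIdeal f ^ i * coeffIdeal f ^ (n - (i + 1)) =
        coeffIdeal f ^ n := by
      rw [← pow_succ', ← pow_add]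
      congr 1
      lia
    have e2 : f.coeff (i + 1) * f.coeff 0 ^ i * f.coeff 0 ^ (n - (i + 1) + 1) =
        f.coeff 0 ^ n * f.coeff (i + 1) := by
      rw [mul_assoc, ← pow_add, mul_comm]
      congr 2
      lia
    rw [e1, e2] at h3
    rw [mul_smul] at h3
    exact h3

/-- A weak form of the **Dedekind-Mertens lemma**, with module coefficients: up to powers of the
content of `f`, the content of `f • g` contains the product of the contents. -/
theorem exists_coeffIdeal_pow_smul_coeffSpan_le (f : R[X]) (g : PolynomialModule R X)
    (H : Submodule R X) (h : ∀ n, (f • g).coeff n ∈ H) :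
    ∃ N : ℕ, coeffIdeal f ^ (N + 1) • coeffSpan g ≤ coeffIdeal f ^ N • H := by
  obtain ⟨m, hm⟩ : ∃ m, ∀ i, m ≤ i → f.coeff i = 0 :=
    ⟨f.natDegree + 1, fun i hi ↦ coeff_eq_zero_of_natDegree_lt (by lia)⟩
  induction m generalizing f g H with
  | zero =>
    refine ⟨0, ?_⟩
    have : coeffIdeal f = ⊥ := by
      rw [coeffIdeal, Ideal.span_eq_bot]
      rintro _ ⟨i, rfl⟩
      exact hm i (Nat.zero_le _)
    simp [this]
  | succ m ih =>
    set a := f.coeff 0 with ha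
    set A : Ideal R := Ideal.span {a} with hA
    set J := coeffIdeal f with hJ
    set J₁ := coeffIdeal f.divX with hJ₁
    set G := coeffSpan g with hG
    have hJsup : J = A ⊔ J₁ := coeffIdeal_eq_sup f
    have hAJ : A ≤ J := hJsup ▸ le_sup_left
    have hJ₁J : J₁ ≤ J := hJsup ▸ le_sup_right
    obtain ⟨n, hn⟩ : ∃ n, A ^ (n + 1) • G ≤ J ^ n • H := by
      refine ⟨g.coeff.support.sup id, ?_⟩
      set n := g.coeff.support.sup id
      rw [hA, Ideal.span_singleton_pow, hG, ← coeffSpan_smul, coeffSpan_le_iff]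
      intro k
      change a ^ (n + 1) • g.coeff k ∈ _
      by_cases hk : g.coeff k = 0
      · simp [hk]
      · have hkn : k ≤ n := Finset.le_sup (f := id) (Finsupp.mem_support_iff.mpr hk)
        have h1 := Submodule.smul_mem_smul
          (Ideal.pow_mem_pow (hAJ (Ideal.mem_span_singleton_self a)) (n - k))
          (pow_succ_smul_coeff_mem h k)
        rw [← Submodule.mul_smul, ← pow_add, smul_smul, ← pow_add, Nat.sub_add_cancel hkn,
          ← add_assoc, Nat.sub_add_cancel hkn] at h1
        exact h1
    -- `i = n + 1` follows from the constant coefficient; in the descent from `i + 1` to `i` the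
    -- induction hypothesis for `f.divX`, the polynomial `(f - a) / t`, is applied to `a ^ i • g`
    have step : ∀ i j, i + j = n + 1 → ∃ N, J ^ (N + 1) • A ^ i • G ≤ J ^ (N + i) • H := by
      intro i j hij
      induction j generalizing i with
      | zero =>
        obtain rfl : i = n + 1 := by lia
        refine ⟨0, ?_⟩
        rw [zero_add, pow_one, zero_add, pow_succ' J, Submodule.mul_smul]
        exact smul_mono_right _ hn
      | succ j ihj =>
        obtain ⟨N', hN'⟩ := ihj (i + 1) (by lia)
        have hcoeff : ∀ k, (f.divX • (a ^ i • g)).coeff k ∈ A ^ i • H ⊔ A ^ (i + 1) • G := by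
          intro k
          have e1 : f.divX • (Polynomial.X : R[X]) • (a ^ i • g) =
              a ^ i • (f • g) - a ^ (i + 1) • g := by
            have h1 : f • g = f.divX • (Polynomial.X : R[X]) • g + a • g := by
              conv_lhs => rw [← divX_mul_X_add f, add_smul, mul_smul]
              rw [← ha, ← algebraMap_eq, algebraMap_smul]
            rw [h1, smul_add, smul_smul (a ^ i) a, ← pow_succ, add_sub_cancel_right]
            rw [smul_comm (Polynomial.X : R[X]) (a ^ i) g, smul_comm f.divX (a ^ i)]
          have e2 : (f.divX • (a ^ i • g)).coeff k =
              (f.divX • (Polynomial.X : R[X]) • (a ^ i • g)).coeff (k + 1) := by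
            rw [smul_comm f.divX (Polynomial.X : R[X]), ← monomial_one_one_eq_X,
              PolynomialModule.monomial_smul_apply]
            simp
          rw [e2, e1]
          have e3 : (a ^ i • (f • g) - a ^ (i + 1) • g).coeff (k + 1) =
            a ^ i • (f • g).coeff (k + 1) + (- (a ^ (i + 1) • g.coeff (k + 1))) := by
            rw [sub_eq_add_neg, PolynomialModule.coeff_add]
            rfl
          rw [e3]
          refine Submodule.add_mem_sup (Submodule.smul_mem_smul
            (Ideal.pow_mem_pow (Ideal.mem_span_singleton_self a) i) (h _)) (neg_mem ?_)
          exact Submodule.smul_mem_smul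
            (Ideal.pow_mem_pow (Ideal.mem_span_singleton_self a) _) (coeff_mem_coeffSpan _ _)
        obtain ⟨N, hN⟩ := ih f.divX (a ^ i • g) _ hcoeff fun k hk ↦ by
          rw [coeff_divX]
          exact hm _ (by lia)
        rw [coeffSpan_smul, ← Ideal.span_singleton_pow, ← hA, ← hG, ← hJ₁] at hN
        refine ⟨N' + 1 + N, ?_⟩
        have hJpow : J ^ (N' + 1 + N + 1) ≤
            J ^ N * (J ^ (N' + 1) * A) ⊔ J ^ (N' + 1) * J₁ ^ (N + 1) := by
          calc J ^ (N' + 1 + N + 1) = J ^ (N' + 1) * J ^ (N + 1) := by rw [← pow_add]; rfl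
            _ ≤ J ^ (N' + 1) * (A * J ^ N ⊔ J₁ ^ (N + 1)) := by
                refine Ideal.mul_mono_right ?_
                rw [hJsup]
                exact Ideal.sup_pow_succ_le A J₁ N
            _ = _ := by
                rw [Ideal.mul_sup]
                congr 1
                ring
        refine (Submodule.smul_mono_left hJpow).trans ?_
        rw [Submodule.sup_smul]
        have hAG : J ^ (N' + 1) • A ^ (i + 1) • G ≤ J ^ (N' + (i + 1)) • H := hN'
        refine sup_le ?_ ?_
        · rw [Submodule.mul_smul, Submodule.mul_smul, ← Submodule.mul_smul A, ← pow_succ']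
          refine (smul_mono_right _ hAG).trans (le_of_eq ?_)
          rw [← Submodule.mul_smul, ← pow_add]
          congr 2
          lia
        · rw [Submodule.mul_smul]
          refine (smul_mono_right _ hN).trans ?_
          rw [Submodule.smul_sup, Submodule.smul_sup]
          refine sup_le ?_ ?_
          · rw [← Submodule.mul_smul, ← Submodule.mul_smul]
            refine Submodule.smul_mono_left ?_
            calc J ^ (N' + 1) * J₁ ^ N * A ^ i = J ^ (N' + 1) * (J₁ ^ N * A ^ i) := mul_assoc _ _ _
              _ ≤ J ^ (N' + 1) * (J ^ N * J ^ i) :=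
                  Ideal.mul_mono_right
                    (Ideal.mul_mono (Ideal.pow_right_mono hJ₁J N) (Ideal.pow_right_mono hAJ i))
              _ = J ^ (N' + 1 + N + i) := by ring
          · rw [← Submodule.mul_smul, mul_comm, Submodule.mul_smul]
            refine (Submodule.smul_mono (Ideal.pow_right_mono hJ₁J N) hAG).trans (le_of_eq ?_)
            rw [← Submodule.mul_smul, ← pow_add]
            congr 2
            lia
    obtain ⟨N, hN⟩ := step 0 (n + 1) (by lia)
    exact ⟨N, by simpa using hN⟩

theorem coeff_mem_of_coeffIdeal_eq_top {f : R[X]} (hf : coeffIdeal f = ⊤)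
    {g : PolynomialModule R X} {H : Submodule R X} (h : ∀ n, (f • g).coeff n ∈ H) (n : ℕ) :
    g.coeff n ∈ H := by
  obtain ⟨N, hN⟩ := exists_coeffIdeal_pow_smul_coeffSpan_le f g H h
  simp only [hf, ← Ideal.one_eq_top, one_pow, Submodule.one_smul] at hN
  exact coeffSpan_le_iff.mp hN n

/-- A polynomial is a nonzerodivisor on `X[t]` if its content contains, up to radical, a
nonzerodivisor on `X`. -/
theorem isSMulRegular_polynomialModule {f : R[X]} {x : R} (hx : IsSMulRegular X x)
    (hxf : x ∈ (coeffIdeal f).radical) : IsSMulRegular (PolynomialModule R X) f := by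
  refine IsSMulRegular.of_right_eq_zero_of_smul fun g hg ↦ ?_
  obtain ⟨s, hs⟩ := hxf
  obtain ⟨N, hN⟩ := exists_coeffIdeal_pow_smul_coeffSpan_le f g ⊥ (by simp [hg])
  rw [Submodule.smul_bot] at hN
  rw [← PolynomialModule.coeff_eq_zero]
  ext n
  have h1 := hN (Submodule.smul_mem_smul (Ideal.pow_mem_pow hs (N + 1)) (coeff_mem_coeffSpan g n))
  rw [← pow_mul, Submodule.mem_bot] at h1
  exact (hx.pow _).right_eq_zero_of_smul h1

theorem exists_coeffIdeal_eq [IsNoetherianRing R] (I : Ideal R) :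
    ∃ f : R[X], coeffIdeal f = I := by
  classical
  obtain ⟨r, b, hb⟩ := Submodule.fg_iff_exists_fin_generating_family.mp
    (IsNoetherian.noetherian I)
  refine ⟨ofFn r b, ?_⟩
  rw [← hb]
  apply le_antisymm
  · rw [coeffIdeal, Ideal.span_le]
    rintro _ ⟨n, rfl⟩
    by_cases hn : n < r
    · rw [ofFn_coeff_eq_val_of_lt b hn]
      exact Submodule.subset_span ⟨_, rfl⟩
    · rw [ofFn_coeff_eq_zero_of_ge b (not_lt.mp hn)]
      exact zero_mem _
  · rw [Submodule.span_le]
    rintro _ ⟨i, rfl⟩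
    have := coeff_mem_coeffIdeal (ofFn r b) i
    rwa [ofFn_coeff_eq_val_of_lt b i.2] at this

theorem algebraMap_mem_map_coeffIdeal (S : Type*) [CommRing S] [Algebra R S] [Algebra R[X] S]
    [IsScalarTower R R[X] S] (f : R[X]) :
    algebraMap R[X] S f ∈ (coeffIdeal f).map (algebraMap R S) := by
  have h1 : f ∈ (coeffIdeal f).map (C : R →+* R[X]) :=
    Ideal.mem_map_C_iff.mpr fun n ↦ coeff_mem_coeffIdeal f n
  have h2 := Ideal.mem_map_of_mem (algebraMap R[X] S) h1
  rwa [Ideal.map_map, ← algebraMap_eq, ← IsScalarTower.algebraMap_eq] at h2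

end Content

/-! ### Ratliff-Rush closedness of high powers -/

section RatliffRush

variable {R X : Type*} [CommRing R] [IsNoetherianRing R] [AddCommGroup X] [Module R X]
  [Module.Finite R X]

/-- If `I` contains, up to radical, a nonzerodivisor on `X`, then `(I ^ (k + 1) X : I) = I ^ k X`
for large `k`. This is the Artin-Rees lemma for the map `X → X ^ r` given by multiplication by
generators of `I`. -/
theorem exists_le_pow_smul_of_smul_le {I : Ideal R} {x : R} (hx : IsSMulRegular X x)
    (hxI : x ∈ I.radical) : ∃ k₀ : ℕ, ∀ k, k₀ ≤ k → ∀ G : Submodule R X,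
      I • G ≤ I ^ (k + 1) • ⊤ → G ≤ I ^ k • ⊤ := by
  obtain ⟨r, b, hb⟩ := Submodule.fg_iff_exists_fin_generating_family.mp
    (IsNoetherian.noetherian I)
  have hbI : ∀ i, b i ∈ I := fun i ↦ hb ▸ Submodule.subset_span ⟨i, rfl⟩
  let u : X →ₗ[R] (Fin r → X) := LinearMap.pi fun i ↦ LinearMap.lsmul R X (b i)
  have hu : Function.Injective u := by
    rw [injective_iff_map_eq_zero]
    intro z hz
    obtain ⟨s, hs⟩ := hxI
    have hI : I ≤ LinearMap.ker (LinearMap.toSpanSingleton R X z) := by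
      rw [← hb, Submodule.span_le]
      rintro _ ⟨i, rfl⟩
      exact congrFun hz i
    exact (hx.pow s).right_eq_zero_of_smul (hI hs)
  obtain ⟨c, hc⟩ := I.exists_pow_inf_eq_pow_smul (LinearMap.range u)
  refine ⟨c, fun k hk G hG z hz ↦ ?_⟩
  have h1 : u z ∈ I ^ (k + 1) • (⊤ : Submodule R (Fin r → X)) ⊓ LinearMap.range u := by
    refine ⟨?_, z, rfl⟩
    have e : u z = ∑ i, LinearMap.single R (fun _ : Fin r ↦ X) i (b i • z) := by
      simp only [LinearMap.coe_single]
      rw [Finset.univ_sum_single]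
      rfl
    rw [e]
    refine Submodule.sum_mem _ fun i _ ↦ ?_
    exact apply_mem_smul_top _ _ (hG (Submodule.smul_mem_smul (hbI i) hz))
  rw [hc _ (by lia), ← Submodule.map_comap_eq_of_le inf_le_right, ← Submodule.map_smul''] at h1
  obtain ⟨z', hz', he⟩ := h1
  obtain rfl := hu he
  have e : k + 1 - c = (k - c) + 1 := by lia
  rw [e, pow_succ, Submodule.mul_smul] at hz'
  have h3 : I • ((I ^ c • ⊤ ⊓ LinearMap.range u).comap u) ≤ I ^ c • (⊤ : Submodule R X) := by
    conv_lhs => rw [← hb]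
    rw [Submodule.span_smul_eq, Submodule.set_smul_le_iff]
    rintro _ w ⟨i, rfl⟩ hw
    rw [hb] at hw
    exact apply_mem_smul_top (I ^ c) (LinearMap.proj i : (Fin r → X) →ₗ[R] X)
      (Submodule.mem_comap.mp hw).1
  have h5 := Submodule.smul_mono (le_refl (I ^ (k - c))) h3 hz'
  rw [← Submodule.mul_smul, ← pow_add, Nat.sub_add_cancel hk] at h5
  exact h5

open Polynomial in
/-- A generic element of `I` is superficial: if the coefficients of `f` generate `I`, then
`(I ^ (k + 1) X[t] : f) = I ^ k X[t]` for large `k`. -/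
theorem exists_coeff_mem_of_coeff_smul_mem {f : R[X]} {x : R} (hx : IsSMulRegular X x)
    (hxI : x ∈ (coeffIdeal f).radical) : ∃ k₀ : ℕ, ∀ k, k₀ ≤ k → ∀ g : PolynomialModule R X,
      (∀ n, (f • g).coeff n ∈ coeffIdeal f ^ (k + 1) • (⊤ : Submodule R X)) →
        ∀ n, g.coeff n ∈ coeffIdeal f ^ k • (⊤ : Submodule R X) := by
  obtain ⟨k₀, hk₀⟩ := exists_le_pow_smul_of_smul_le (X := X) hx hxI
  refine ⟨k₀, fun k hk g hg ↦ coeffSpan_le_iff.mp ?_⟩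
  set I := coeffIdeal f
  have peel : ∀ N, I ^ N • coeffSpan g ≤ I ^ (k + N) • ⊤ → coeffSpan g ≤ I ^ k • ⊤ := by
    intro N
    induction N with
    | zero => intro h; simpa using h
    | succ N ih =>
      intro h
      refine ih (hk₀ (k + N) (by lia) _ ?_)
      rwa [← Submodule.mul_smul, ← pow_succ']
  obtain ⟨N, hN⟩ := exists_coeffIdeal_pow_smul_coeffSpan_le f g _ hg
  refine peel (N + 1) (hN.trans (le_of_eq ?_))
  rw [← Submodule.mul_smul, ← pow_add]
  congr 2
  lia

end RatliffRush

/-! ### Base change of lengths -/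

section BaseChange

variable {R : Type*} (S : Type*) {X : Type*} [CommRing R] [CommRing S] [Algebra R S]
  [AddCommGroup X] [Module R X]

theorem nonempty_baseChange_quotient_smul_equiv (J : Ideal R) :
    Nonempty (((S ⊗[R] X) ⧸ J.map (algebraMap R S) • (⊤ : Submodule S (S ⊗[R] X))) ≃ₗ[S]
      S ⊗[R] (X ⧸ J • (⊤ : Submodule R X))) := by
  let q : S ⊗[R] X →ₗ[S] S ⊗[R] (X ⧸ J • (⊤ : Submodule R X)) :=
    (J • (⊤ : Submodule R X)).mkQ.baseChange S
  have hq : Function.Surjective q :=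
    LinearMap.lTensor_surjective S (Submodule.mkQ_surjective _)
  have hker : LinearMap.ker q = J.map (algebraMap R S) • ⊤ := by
    apply le_antisymm
    · intro z hz
      have h3 : z ∈ LinearMap.ker ((J • (⊤ : Submodule R X)).mkQ.lTensor S) := hz
      rw [LinearMap.exact_iff.mp (lTensor_exact S (LinearMap.exact_subtype_mkQ _)
        (Submodule.mkQ_surjective _))] at h3
      obtain ⟨w, rfl⟩ := h3
      induction w with
      | zero => simp
      | add a b ha hb =>
        rw [map_add]
        refine add_mem (ha ?_) (hb ?_)
        all_goals
          exact LinearMap.congr_fun (f := (J • (⊤ : Submodule R X)).mkQ.lTensor S ∘ₗ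
            (J • (⊤ : Submodule R X)).subtype.lTensor S) (g := 0) (by
              rw [← LinearMap.lTensor_comp, (LinearMap.exact_subtype_mkQ _).linearMap_comp_eq_zero,
                LinearMap.lTensor_zero]) _
      | tmul s y =>
        obtain ⟨y, hy⟩ := y
        rw [LinearMap.lTensor_tmul, Submodule.subtype_apply]
        clear hz
        induction hy using Submodule.smul_induction_on' with
        | smul r hr x _ =>
          rw [TensorProduct.tmul_smul, ← algebraMap_smul S r]
          exact Submodule.smul_mem_smul (Ideal.mem_map_of_mem _ hr) trivial
        | add a _ b _ ha hb =>
          rw [TensorProduct.tmul_add]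
          exact add_mem ha hb
    · rw [Ideal.map, Submodule.span_smul_eq, Submodule.set_smul_le_iff]
      rintro _ w ⟨r, hr, rfl⟩ -
      rw [LinearMap.mem_ker, map_smul]
      generalize q w = y
      induction y with
      | zero => simp
      | add a b ha hb => rw [smul_add, ha, hb, add_zero]
      | tmul s y =>
        obtain ⟨y, rfl⟩ := Submodule.mkQ_surjective _ y
        rw [algebraMap_smul, ← TensorProduct.tmul_smul, ← map_smul, Submodule.mkQ_apply,
          (Submodule.Quotient.mk_eq_zero _).mpr (Submodule.smul_mem_smul hr Submodule.mem_top),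
          TensorProduct.tmul_zero]
  rw [← hker]
  exact ⟨q.quotKerEquivOfSurjective hq⟩

theorem length_baseChange_quotient_smul [IsLocalRing R] [IsLocalRing S]
    [IsLocalHom (algebraMap R S)] [Module.Flat R S]
    (hS : (IsLocalRing.maximalIdeal R).map (algebraMap R S) = IsLocalRing.maximalIdeal S)
    (J : Ideal R) :
    Module.length S ((S ⊗[R] X) ⧸ J.map (algebraMap R S) • (⊤ : Submodule S (S ⊗[R] X))) =
      Module.length R (X ⧸ J • (⊤ : Submodule R X)) := by
  have h1 : Module.length S (S ⧸ (IsLocalRing.maximalIdeal R).map (algebraMap R S)) = 1 := by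
    rw [hS, Module.length_eq_one_iff]
    exact isSimpleModule_iff_quot_maximal.mpr
      ⟨_, IsLocalRing.maximalIdeal.isMaximal S, ⟨LinearEquiv.refl _ _⟩⟩
  have h2 := IsLocalRing.length_baseChange R S (X ⧸ J • (⊤ : Submodule R X))
  rw [h1, mul_one] at h2
  obtain ⟨e⟩ := nonempty_baseChange_quotient_smul_equiv S (X := X) J
  rw [← h2, e.length_eq]

end BaseChange

/-! ### The generic local extension `R[t]_{𝔪[t]}` -/

section GenericExtension

open Polynomial

variable {R : Type*} [CommRing R] [IsLocalRing R] {S : Type*} [CommRing S] [Algebra R S]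
  [Algebra R[X] S] [IsScalarTower R R[X] S]
  [IsLocalization.AtPrime S ((IsLocalRing.maximalIdeal R).map (C : R →+* R[X]))]
  {Y : Type*} [AddCommGroup Y] [Module R Y]

theorem coeffIdeal_eq_top_of_notMem {f : R[X]}
    (hf : f ∉ (IsLocalRing.maximalIdeal R).map (C : R →+* R[X])) : coeffIdeal f = ⊤ := by
  by_contra h
  exact hf (Ideal.mem_map_C_iff.mpr fun n ↦
    IsLocalRing.le_maximalIdeal h (coeff_mem_coeffIdeal f n))

variable (S) in
theorem isLocalHom_algebraMap_of_isLocalization_map_C [IsLocalRing S] :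
    IsLocalHom (algebraMap R S) := by
  refine ⟨fun a ha ↦ ?_⟩
  by_contra h
  have h1 : C a ∈ (IsLocalRing.maximalIdeal R).map (C : R →+* R[X]) :=
    Ideal.mem_map_of_mem _ h
  rw [IsScalarTower.algebraMap_apply R R[X] S,
    IsLocalization.AtPrime.isUnit_to_map_iff S
      ((IsLocalRing.maximalIdeal R).map (C : R →+* R[X]))] at ha
  exact ha h1

variable (S) in
theorem map_maximalIdeal_of_isLocalization_map_C [IsLocalRing S] :
    (IsLocalRing.maximalIdeal R).map (algebraMap R S) = IsLocalRing.maximalIdeal S := by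
  rw [IsScalarTower.algebraMap_eq R R[X] S, ← Ideal.map_map]
  exact IsLocalization.AtPrime.map_eq_maximalIdeal
    ((IsLocalRing.maximalIdeal R).map (C : R →+* R[X])) S

variable (S Y) in
/-- `S ⊗ Y` is a localization of `Y[t]`. -/
theorem exists_isLocalizedModule_polynomialModule :
    ∃ l : PolynomialModule R Y →ₗ[R[X]] S ⊗[R] Y,
      IsLocalizedModule ((IsLocalRing.maximalIdeal R).map (C : R →+* R[X])).primeCompl l ∧
        ∀ y, l (PolynomialModule.single R 0 y) = 1 ⊗ₜ y := by
  have h1 : IsBaseChange R[X] (PolynomialModule.lsingle R (M := Y) 0) :=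
    IsBaseChange.of_equiv
      (PolynomialModule.polynomialTensorProductLEquivPolynomialModule R Y) fun y ↦ by
        change (LinearMap.liftBaseChange R[X] (PolynomialModule.lsingle R 0)) (1 ⊗ₜ y) = _
        simp
  let l := h1.lift (TensorProduct.mk R S Y 1)
  have hl : (l.restrictScalars R) ∘ₗ PolynomialModule.lsingle R (M := Y) 0 =
      TensorProduct.mk R S Y 1 := h1.lift_comp _
  have h2 : IsBaseChange S ((l.restrictScalars R) ∘ₗ PolynomialModule.lsingle R (M := Y) 0) := by
    rw [hl]
    exact TensorProduct.isBaseChange R Y S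
  exact ⟨l, (isLocalizedModule_iff_isBaseChange _ S l).mpr (IsBaseChange.of_comp h1 h2),
    fun y ↦ LinearMap.congr_fun hl y⟩

/-- The polynomials with coefficients in a given submodule. -/
def polynomialSubmodule (H : Submodule R Y) : Submodule R[X] (PolynomialModule R Y) where
  carrier := {g | ∀ n, g.coeff n ∈ H}
  zero_mem' := fun _ ↦ H.zero_mem
  add_mem' := fun ha hb n ↦ H.add_mem (ha n) (hb n)
  smul_mem' := fun f g hg n ↦ by
    rw [PolynomialModule.smul_apply]
    exact H.sum_mem fun x _ ↦ H.smul_mem _ (hg _)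

theorem localized'_polynomialSubmodule (l : PolynomialModule R Y →ₗ[R[X]] S ⊗[R] Y)
    [IsLocalizedModule ((IsLocalRing.maximalIdeal R).map (C : R →+* R[X])).primeCompl l]
    (hl : ∀ y, l (PolynomialModule.single R 0 y) = 1 ⊗ₜ y) (J : Ideal R) :
    (polynomialSubmodule (J • (⊤ : Submodule R Y))).localized' S
      ((IsLocalRing.maximalIdeal R).map (C : R →+* R[X])).primeCompl l =
        J.map (algebraMap R S) • ⊤ := by
  apply le_antisymm
  · rw [Submodule.localized'_eq_span, Submodule.span_le]
    rintro _ ⟨g, hg, rfl⟩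
    have h1 : g = ∑ n ∈ g.coeff.support, (monomial n (1 : R)) •
        PolynomialModule.single R 0 (g.coeff n) := by
      rw [← PolynomialModule.coeff_inj, PolynomialModule.coeff_sum]
      conv_lhs => rw [← Finsupp.sum_single g.coeff]
      exact Finset.sum_congr rfl fun n _ ↦ by simp
    rw [h1, map_sum]
    refine sum_mem fun n _ ↦ ?_
    rw [map_smul, hl, ← algebraMap_smul S (monomial n (1 : R))]
    refine Submodule.smul_mem _ _ ?_
    have h2 := hg n
    generalize g.coeff n = y at h2
    induction h2 using Submodule.smul_induction_on' with
    | smul r hr x _ =>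
      rw [TensorProduct.tmul_smul, ← algebraMap_smul S r]
      exact Submodule.smul_mem_smul (Ideal.mem_map_of_mem _ hr) Submodule.mem_top
    | add a _ b _ ha hb =>
      rw [TensorProduct.tmul_add]
      exact add_mem ha hb
  · rw [Ideal.map, Submodule.span_smul_eq, Submodule.set_smul_le_iff]
    rintro _ w ⟨r, hr, rfl⟩ -
    obtain ⟨⟨g, s⟩, rfl⟩ := IsLocalizedModule.mk'_surjective
      ((IsLocalRing.maximalIdeal R).map (C : R →+* R[X])).primeCompl l w
    rw [Submodule.mem_localized']
    refine ⟨C r • g, fun n ↦ ?_, s, ?_⟩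
    · rw [← algebraMap_eq, algebraMap_smul]
      exact Submodule.smul_mem_smul hr Submodule.mem_top
    · rw [IsLocalizedModule.mk'_smul, IsScalarTower.algebraMap_apply R R[X] S, algebraMap_smul]
      rfl

variable (S) in
theorem isSMulRegular_baseChange {f : R[X]} {x : R} (hx : IsSMulRegular Y x)
    (hxf : x ∈ (coeffIdeal f).radical) : IsSMulRegular (S ⊗[R] Y) (algebraMap R[X] S f) := by
  obtain ⟨l, hl, -⟩ := exists_isLocalizedModule_polynomialModule (R := R) S Y
  have h1 := (RingTheory.Sequence.isWeaklyRegular_singleton_iff _ f).mpr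
    (isSMulRegular_polynomialModule (X := Y) hx hxf)
  have h2 := h1.of_isLocalizedModule S
    ((IsLocalRing.maximalIdeal R).map (C : R →+* R[X])).primeCompl l
  exact (RingTheory.Sequence.isWeaklyRegular_singleton_iff _ _).mp h2

variable (S) in
/-- Over the generic extension the polynomial `f` is a superficial element of the extension of its
coefficient ideal. -/
theorem exists_mem_of_smul_mem_baseChange [IsNoetherianRing R] [Module.Finite R Y] {f : R[X]}
    {x : R} (hx : IsSMulRegular Y x) (hxf : x ∈ (coeffIdeal f).radical) :
    ∃ k₀ : ℕ, ∀ k, k₀ ≤ k → ∀ y : S ⊗[R] Y,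
      algebraMap R[X] S f • y ∈ (coeffIdeal f ^ (k + 1)).map (algebraMap R S) •
        (⊤ : Submodule S (S ⊗[R] Y)) →
      y ∈ (coeffIdeal f ^ k).map (algebraMap R S) • (⊤ : Submodule S (S ⊗[R] Y)) := by
  obtain ⟨l, hl, hl1⟩ := exists_isLocalizedModule_polynomialModule (R := R) S Y
  obtain ⟨k₀, hk₀⟩ := exists_coeff_mem_of_coeff_smul_mem (X := Y) hx hxf
  refine ⟨k₀, fun k hk y hy ↦ ?_⟩
  obtain ⟨⟨g, s⟩, rfl⟩ := IsLocalizedModule.mk'_surjective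
      ((IsLocalRing.maximalIdeal R).map (C : R →+* R[X])).primeCompl l y
  rw [← localized'_polynomialSubmodule l hl1, Submodule.mem_localized'] at hy ⊢
  obtain ⟨g', hg', s', h⟩ := hy
  rw [algebraMap_smul] at h
  change _ = f • IsLocalizedModule.mk' l g s at h
  rw [← IsLocalizedModule.mk'_smul, IsLocalizedModule.mk'_eq_mk'_iff] at h
  obtain ⟨c, hc⟩ := h
  refine ⟨g, hk₀ k hk g ?_, s, rfl⟩
  refine coeff_mem_of_coeffIdeal_eq_top (coeffIdeal_eq_top_of_notMem s'.2) ?_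
  refine coeff_mem_of_coeffIdeal_eq_top (coeffIdeal_eq_top_of_notMem c.2) ?_
  have h3 : c • s' • f • g ∈
      polynomialSubmodule (coeffIdeal f ^ (k + 1) • (⊤ : Submodule R Y)) := by
    rw [hc]
    exact Submodule.smul_mem _ _ (Submodule.smul_mem _ _ hg')
  exact h3

variable (S) in
theorem radical_map_of_isLocalization_map_C [IsLocalRing S] {I : Ideal R}
    (hI : I.radical = IsLocalRing.maximalIdeal R) :
    (I.map (algebraMap R S)).radical = IsLocalRing.maximalIdeal S := by
  have hS := map_maximalIdeal_of_isLocalization_map_C (R := R) S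
  have h1 : (IsLocalRing.maximalIdeal S).IsPrime :=
    (IsLocalRing.maximalIdeal.isMaximal S).isPrime
  apply le_antisymm
  · rw [h1.radical_le_iff, ← hS, ← hI]
    exact Ideal.map_mono Ideal.le_radical
  · have h2 := Ideal.map_radical_le (f := algebraMap R S) (I := I)
    rwa [hI, hS] at h2

open RingTheory.Sequence in
variable (S) in
/-- A regular sequence of length `d + 1` on `Y` gives one of length `d` on
`(S ⊗ Y) / f (S ⊗ Y)`: the last member of the sequence can be exchanged for the generic
element `f`, and `f` can be moved to the front. -/
theorem isWeaklyRegular_quotSMulTop_baseChange [IsNoetherianRing R] [IsLocalRing S]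
    [IsNoetherianRing S] [Module.Flat R S] [Module.Finite R Y] {f : R[X]} {x : R}
    (hfm : coeffIdeal f ≤ IsLocalRing.maximalIdeal R) (hxf : x ∈ (coeffIdeal f).radical)
    {rs : List R} (hrs : ∀ r ∈ rs, r ∈ IsLocalRing.maximalIdeal R)
    (hreg : IsWeaklyRegular Y (rs ++ [x])) :
    IsWeaklyRegular (QuotSMulTop (algebraMap R[X] S f) (S ⊗[R] Y))
      (rs.map (algebraMap R S)) := by
  have hS := map_maximalIdeal_of_isLocalization_map_C (R := R) S
  rw [isWeaklyRegular_append_iff, isWeaklyRegular_singleton_iff] at hreg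
  have h1 : IsWeaklyRegular (S ⊗[R] Y) (rs.map (algebraMap R S) ++ [algebraMap R[X] S f]) := by
    rw [isWeaklyRegular_append_iff, isWeaklyRegular_singleton_iff]
    refine ⟨hreg.1.of_flat_of_isBaseChange (TensorProduct.isBaseChange R Y S), ?_⟩
    obtain ⟨e⟩ := nonempty_baseChange_quotient_smul_equiv S (X := Y) (Ideal.ofList rs)
    rw [← Ideal.map_ofList]
    exact (LinearEquiv.isSMulRegular_congr e _).mpr (isSMulRegular_baseChange S hreg.2 hxf)
  refine ((isWeaklyRegular_cons_iff _ _ _).mp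
    (IsLocalRing.isWeaklyRegular_of_perm_of_subset_maximalIdeal h1
      (List.perm_append_singleton _ _) fun r hr ↦ ?_)).2
  rcases List.mem_append.mp hr with h | h
  · obtain ⟨a, ha, rfl⟩ := List.mem_map.mp h
    rw [← hS]
    exact Ideal.mem_map_of_mem _ (hrs a ha)
  · rw [List.mem_singleton.mp h, ← hS]
    exact Ideal.map_mono hfm (algebraMap_mem_map_coeffIdeal S f)

open scoped Pointwise in
theorem length_quotient_smul_le_quotSMulTop {A W : Type*} [CommRing A] [AddCommGroup W]
    [Module A W] {J : Ideal A} {a : A} (ha : a ∈ J) :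
    Module.length A (W ⧸ J • (⊤ : Submodule A W)) ≤
      Module.length A (QuotSMulTop a W ⧸ J • (⊤ : Submodule A (QuotSMulTop a W))) := by
  refine length_quotient_smul_le_of_ker_le (Submodule.mkQ _) (Submodule.mkQ_surjective _) ?_
  rw [Submodule.ker_mkQ]
  rintro _ ⟨y, -, rfl⟩
  exact Submodule.smul_mem_smul ha Submodule.mem_top

variable (S) in
/-- Passing to the quotient by a generic element of `I` takes the difference of the
Hilbert-Samuel function. -/
theorem exists_length_add_length_quotSMulTop_le [IsNoetherianRing R] [IsLocalRing S]
    [Module.Flat R S] [Module.Finite R Y] {f : R[X]} {x : R} (hx : IsSMulRegular Y x)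
    (hxf : x ∈ (coeffIdeal f).radical) : ∃ n₀ : ℕ, ∀ n, n₀ ≤ n →
      Module.length R (Y ⧸ coeffIdeal f ^ n • (⊤ : Submodule R Y)) +
        Module.length S (QuotSMulTop (algebraMap R[X] S f) (S ⊗[R] Y) ⧸
          (coeffIdeal f).map (algebraMap R S) ^ (n + 1) •
            (⊤ : Submodule S (QuotSMulTop (algebraMap R[X] S f) (S ⊗[R] Y)))) ≤
        Module.length R (Y ⧸ coeffIdeal f ^ (n + 1) • (⊤ : Submodule R Y)) := by
  have : IsLocalHom (algebraMap R S) := isLocalHom_algebraMap_of_isLocalization_map_C S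
  have hS := map_maximalIdeal_of_isLocalization_map_C (R := R) S
  obtain ⟨n₀, hn₀⟩ := exists_mem_of_smul_mem_baseChange S hx hxf
  refine ⟨n₀, fun n hn ↦ ?_⟩
  rw [← length_baseChange_quotient_smul S hS (X := Y),
    ← length_baseChange_quotient_smul S hS (X := Y), ← Ideal.map_pow]
  refine length_add_length_le _ _ (LinearMap.lsmul S (S ⊗[R] Y) (algebraMap R[X] S f))
    (Submodule.mkQ _) (Submodule.mkQ_surjective _) ?_ (hn₀ n hn)
  refine LinearMap.ext fun y ↦ (Submodule.Quotient.mk_eq_zero _).mpr ?_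
  exact Submodule.smul_mem_pointwise_smul _ _ _ Submodule.mem_top

end GenericExtension

/-! ### Lower bound for the Hilbert-Samuel function of a Cohen-Macaulay module -/

open RingTheory.Sequence in
open Polynomial in
/-- If `Y` admits a regular sequence of length `d`, its Hilbert-Samuel function with respect to `I`
dominates, up to a shift, the function `k ↦ ℓ(Y / I Y) * choose (k + d) d`. In the inductive step
`Y` is replaced by `(S ⊗ Y) / f (S ⊗ Y)`, where `S = R[t]_{𝔪[t]}` and the coefficients of `f`
generate `I`. -/
theorem exists_length_mul_choose_le (d : ℕ) (R : Type u) [CommRing R] [IsLocalRing R]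
    [IsNoetherianRing R] (I : Ideal R) (hI : I.radical = IsLocalRing.maximalIdeal R) (Y : Type u)
    [AddCommGroup Y] [Module R Y] [Module.Finite R Y] (rs : List R) (hd : rs.length = d)
    (hrs : ∀ r ∈ rs, r ∈ IsLocalRing.maximalIdeal R) (hreg : IsWeaklyRegular Y rs) :
    ∃ K : ℕ, ∀ k : ℕ, Module.length R (Y ⧸ I • (⊤ : Submodule R Y)) * ((k + d).choose d : ℕ) ≤
      Module.length R (Y ⧸ I ^ (k + K) • (⊤ : Submodule R Y)) := by
  induction d generalizing R I Y rs with
  | zero =>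
    refine ⟨1, fun k ↦ ?_⟩
    simpa using length_quotient_smul_anti (Y := Y) (Ideal.pow_le_self (I := I) (Nat.succ_ne_zero k))
  | succ d ih =>
    obtain ⟨rs, x, rfl⟩ : ∃ rs' x, rs = rs' ++ [x] :=
      ⟨rs.dropLast, rs.getLast (by grind), (List.dropLast_append_getLast _).symm⟩
    obtain ⟨f, rfl⟩ := exists_coeffIdeal_eq I
    have hxI : x ∈ (coeffIdeal f).radical := by
      rw [hI]
      exact hrs x (by simp)
    have hx : IsSMulRegular Y x := ((isWeaklyRegular_cons_iff _ _ _).mp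
      (IsLocalRing.isWeaklyRegular_of_perm_of_subset_maximalIdeal hreg
        (List.perm_append_singleton _ _) hrs)).1
    let S := Localization.AtPrime ((IsLocalRing.maximalIdeal R).map (C : R →+* R[X]))
    have hflat : Module.Flat R S := Module.Flat.trans R R[X] S
    have hnoeth : IsNoetherianRing S := IsLocalization.isNoetherianRing
      ((IsLocalRing.maximalIdeal R).map (C : R →+* R[X])).primeCompl S inferInstance
    have hloc : IsLocalHom (algebraMap R S) := isLocalHom_algebraMap_of_isLocalization_map_C S
    have hS : (IsLocalRing.maximalIdeal R).map (algebraMap R S) = IsLocalRing.maximalIdeal S :=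
      map_maximalIdeal_of_isLocalization_map_C S
    have hrs₁ : ∀ r ∈ rs, r ∈ IsLocalRing.maximalIdeal R := fun r hr ↦ hrs r (by simp [hr])
    obtain ⟨K₁, hK₁⟩ := ih S ((coeffIdeal f).map (algebraMap R S))
      (radical_map_of_isLocalization_map_C S hI)
      (QuotSMulTop (algebraMap R[X] S f) (S ⊗[R] Y)) (rs.map (algebraMap R S))
      (by simpa using hd) (fun r hr ↦ by
        obtain ⟨a, ha, rfl⟩ := List.mem_map.mp hr
        rw [← hS]
        exact Ideal.mem_map_of_mem _ (hrs₁ a ha))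
      (isWeaklyRegular_quotSMulTop_baseChange S (hI ▸ Ideal.le_radical) hxI hrs₁ hreg)
    obtain ⟨n₀, hn₀⟩ := exists_length_add_length_quotSMulTop_le S hx hxI
    have hL := length_quotient_smul_le_quotSMulTop (W := S ⊗[R] Y)
      (algebraMap_mem_map_coeffIdeal S f)
    rw [length_baseChange_quotient_smul S hS] at hL
    obtain ⟨K, hK⟩ := exists_mul_choose_le_of_add_le (m := 1) (c := 1) (K₀ := 1) (K₁ := K₁)
      (L := Module.length R (Y ⧸ coeffIdeal f • (⊤ : Submodule R Y)))
      (length_quotient_pow_smul_monotone (Y := Y) (coeffIdeal f))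
      (length_quotient_pow_smul_monotone (Y := QuotSMulTop (algebraMap R[X] S f) (S ⊗[R] Y))
        ((coeffIdeal f).map (algebraMap R S))) one_pos one_pos (by rw [pow_one])
      (fun k ↦ by
        rw [one_mul]
        exact (mul_le_mul_left hL _).trans (hK₁ k)) hn₀
    refine ⟨K, fun k ↦ ?_⟩
    have h := hK k
    rwa [mul_one, one_mul] at h

/-! ### `Tor₁` and syzygies -/

section Tor

variable {R : Type u} [CommRing R]

/-- Comparison of an arbitrary presentation `F → N` with the beginning `P₂ → P₁ → P₀ → N` of a
projective resolution: if the first homology of `M ⊗ P` is killed elementwise by a submonoid `T`,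
so is the kernel of `M ⊗ ker p → M ⊗ F`. -/
theorem exists_smul_eq_zero_of_exists_lTensor_eq {M N F P₀ P₁ P₂ : Type*}
    [AddCommGroup M] [Module R M] [AddCommGroup N] [Module R N] [AddCommGroup F] [Module R F]
    [AddCommGroup P₀] [Module R P₀] [AddCommGroup P₁] [Module R P₁] [AddCommGroup P₂] [Module R P₂]
    [Module.Projective R F] [Module.Projective R P₀] {T : Submonoid R}
    {d₂ : P₂ →ₗ[R] P₁} {d₁ : P₁ →ₗ[R] P₀} {e : P₀ →ₗ[R] N} {p : F →ₗ[R] N}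
    (hd : d₁ ∘ₗ d₂ = 0) (hex : Function.Exact d₁ e) (he : Function.Surjective e)
    (hp : Function.Surjective p)
    (H : ∀ x : M ⊗[R] P₁, d₁.lTensor M x = 0 → ∃ s ∈ T, ∃ y, d₂.lTensor M y = s • x)
    (w : M ⊗[R] LinearMap.ker p) (hw : (LinearMap.ker p).subtype.lTensor M w = 0) :
    ∃ s ∈ T, s • w = 0 := by
  obtain ⟨a, ha⟩ := Module.projective_lifting_property e p he
  obtain ⟨b, hb⟩ := Module.projective_lifting_property p e hp
  have ha' : ∀ f, e (a f) = p f := LinearMap.congr_fun ha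
  have hb' : ∀ f, p (b f) = e f := LinearMap.congr_fun hb
  let aL : LinearMap.ker p →ₗ[R] LinearMap.ker e :=
    a.restrict fun f hf ↦ by rwa [LinearMap.mem_ker, ha']
  let bL : LinearMap.ker e →ₗ[R] LinearMap.ker p :=
    b.restrict fun f hf ↦ by rwa [LinearMap.mem_ker, hb']
  let d : P₁ →ₗ[R] LinearMap.ker e := d₁.codRestrict _ hex.apply_apply_eq_zero
  -- `b ∘ a` is the identity on the syzygy, up to a map which factors through `F`
  let h : F →ₗ[R] LinearMap.ker p := (b ∘ₗ a - LinearMap.id).codRestrict _ fun f ↦ by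
    simp [hb', ha']
  have hh : bL ∘ₗ aL = LinearMap.id + h ∘ₗ (LinearMap.ker p).subtype := by
    ext f
    simp [h, aL, bL]
  have hdsurj : Function.Surjective d := by
    rintro ⟨z, hz⟩
    obtain ⟨y, rfl⟩ := (hex z).mp hz
    exact ⟨y, rfl⟩
  obtain ⟨x, hx⟩ := LinearMap.lTensor_surjective M hdsurj (aL.lTensor M w)
  have h1 : d₁.lTensor M x = 0 := by
    have e1 : d₁ = (LinearMap.ker e).subtype ∘ₗ d := rfl
    have e2 : (LinearMap.ker e).subtype ∘ₗ aL = a ∘ₗ (LinearMap.ker p).subtype := rfl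
    rw [e1, LinearMap.lTensor_comp_apply, hx, ← LinearMap.lTensor_comp_apply, e2,
      LinearMap.lTensor_comp_apply, hw, map_zero]
  obtain ⟨s, hs, y, hy⟩ := H x h1
  refine ⟨s, hs, ?_⟩
  have h2 : s • aL.lTensor M w = 0 := by
    have e1 : d ∘ₗ d₂ = 0 := by
      ext z
      exact LinearMap.congr_fun hd z
    rw [← hx, ← map_smul, ← hy, ← LinearMap.lTensor_comp_apply, e1, LinearMap.lTensor_zero,
      LinearMap.zero_apply]
  have h3 : bL.lTensor M (aL.lTensor M w) = w := by
    rw [← LinearMap.lTensor_comp_apply, hh, LinearMap.lTensor_add, LinearMap.lTensor_id,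
      LinearMap.add_apply, LinearMap.id_apply, LinearMap.lTensor_comp_apply, hw, map_zero,
      add_zero]
  rw [← h3, ← map_smul, h2, map_zero]

theorem CategoryTheory.ShortComplex.exists_f_apply_eq_smul (C : ShortComplex (ModuleCat.{u} R))
    {T : Submonoid R} (H : ∀ t : C.homology, ∃ s ∈ T, s • t = 0) (x : C.X₂)
    (hx : C.g.hom x = 0) : ∃ s ∈ T, ∃ y, C.f.hom y = s • x := by
  let z : LinearMap.ker C.g.hom := ⟨x, hx⟩
  let t : C.moduleCatLeftHomologyData.H := (LinearMap.range C.moduleCatToCycles).mkQ z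
  obtain ⟨s, hs, hst⟩ := H (C.moduleCatHomologyIso.inv.hom t)
  refine ⟨s, hs, ?_⟩
  have h1 : s • t = 0 := by
    have h2 := congrArg C.moduleCatHomologyIso.hom.hom hst
    rw [map_smul, map_zero] at h2
    rwa [← LinearMap.comp_apply, ← ModuleCat.hom_comp, Iso.inv_hom_id] at h2
  have h3 : s • z ∈ LinearMap.range C.moduleCatToCycles := by
    rw [← Submodule.Quotient.mk_eq_zero]
    exact h1
  obtain ⟨y, hy⟩ := h3
  exact ⟨y, congrArg Subtype.val hy⟩

/-- The kernel of `M ⊗ ker p → M ⊗ F`, for a presentation `p : F → N`, is killed elementwise by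
every submonoid which kills `Tor₁(M, N)` elementwise. -/
theorem exists_smul_eq_zero_of_Tor1 {M N F : Type u} [AddCommGroup M] [Module R M]
    [AddCommGroup N] [Module R N] [AddCommGroup F] [Module R F] [Module.Projective R F]
    {T : Submonoid R} (hT : ∀ t : UlrichMod.Tor1 R M N, ∃ s ∈ T, s • t = 0)
    {p : F →ₗ[R] N} (hp : Function.Surjective p) (w : M ⊗[R] LinearMap.ker p)
    (hw : (LinearMap.ker p).subtype.lTensor M w = 0) : ∃ s ∈ T, s • w = 0 := by
  obtain ⟨P⟩ := (inferInstance : HasProjectiveResolution (ModuleCat.of R N)).out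
  let G := (MonoidalCategory.tensoringLeft (ModuleCat.{u} R)).obj (ModuleCat.of R M)
  let C := (G.mapHomologicalComplex _).obj P.complex
  let i : UlrichMod.Tor1 R M N ≅ (C.sc' 2 1 0).homology :=
    P.isoLeftDerivedObj G 1 ≪≫
      ShortComplex.homologyMapIso (C.isoSc' 2 1 0 (by simp) (by simp))
  have hproj : Module.Projective R (P.complex.X 0) :=
    (IsProjective.iff_projective _).mpr (P.projective 0)
  have hex : (ShortComplex.mk _ _ P.complex_d_comp_π_f_zero).Exact :=
    ShortComplex.exact_of_g_is_cokernel _ P.isColimitCokernelCofork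
  refine exists_smul_eq_zero_of_exists_lTensor_eq (d₂ := (P.complex.d 2 1).hom)
    (d₁ := (P.complex.d 1 0).hom) (e := (P.π.f 0).hom) ?_ ?_ ?_ hp ?_ w hw
  · rw [← ModuleCat.hom_comp, P.complex.d_comp_d]
    rfl
  · exact (ShortComplex.ShortExact.moduleCat_exact_iff_function_exact _).mp hex
  · exact (ModuleCat.epi_iff_surjective (P.π.f 0)).mp inferInstance
  · intro x hx
    refine (C.sc' 2 1 0).exists_f_apply_eq_smul (fun t ↦ ?_) x hx
    obtain ⟨s, hs, hst⟩ := hT (i.inv.hom t)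
    refine ⟨s, hs, ?_⟩
    have h1 := congrArg i.hom.hom hst
    rw [map_smul, map_zero] at h1
    rwa [← LinearMap.comp_apply, ← ModuleCat.hom_comp, Iso.inv_hom_id] at h1

end Tor

/-! ### Asymptotic comparison -/

theorem Nat.pow_le_factorial_mul_choose (k d : ℕ) : k ^ d ≤ d ! * (k + d).choose d := by
  rw [← Nat.ascFactorial_eq_factorial_mul_choose]
  exact (Nat.pow_le_pow_left (Nat.le_succ k) d).trans (Nat.pow_succ_le_ascFactorial _ _)

/-- If `a` grows like `L j ^ d / d!`, then `n * a` cannot exceed `n * L * choose (j + d) d` by a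
term of order `j ^ d`. -/
theorem not_forall_choose_add_choose_le {a : ℕ → ℕ} {d L n m K : ℕ} (hm : 0 < m)
    (ha : Tendsto (fun j : ℕ ↦ (d ! : ℝ) * ((a j : ℝ) / (j : ℝ) ^ d)) atTop (𝓝 (L : ℝ)))
    (h : ∀ k : ℕ, n * L * (m * k + d).choose d + (k + d).choose d ≤ n * a (m * k + K)) :
    False := by
  have hm' : (0 : ℝ) < m := by exact_mod_cast hm
  have hlim : Tendsto (fun k : ℕ ↦ (k : ℝ) / (m * k + K : ℕ)) atTop (𝓝 (1 / m)) := by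
    have h1 : Tendsto (fun k : ℕ ↦ (1 : ℝ) / (m + K / k)) atTop (𝓝 (1 / (m + 0))) :=
      tendsto_const_nhds.div (tendsto_const_nhds.add (tendsto_const_div_atTop_nhds_zero_nat _))
        (by positivity)
    rw [add_zero] at h1
    refine h1.congr' ?_
    filter_upwards [eventually_gt_atTop 0] with k hk
    have : (0 : ℝ) < k := by exact_mod_cast hk
    push_cast
    field_simp
  have hsub : Tendsto (fun k : ℕ ↦ m * k + K) atTop atTop :=
    tendsto_atTop_mono (fun k ↦ show k ≤ m * k + K from
      (Nat.le_mul_of_pos_left k hm).trans (Nat.le_add_right _ _)) tendsto_id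
  have hR : Tendsto (fun k : ℕ ↦ (n : ℝ) * ((d ! : ℝ) *
      ((a (m * k + K) : ℝ) / ((m * k + K : ℕ) : ℝ) ^ d))) atTop (𝓝 (n * L)) :=
    (ha.comp hsub).const_mul _
  have hL : Tendsto (fun k : ℕ ↦ (n * L : ℝ) * (m * ((k : ℝ) / (m * k + K : ℕ))) ^ d +
      ((k : ℝ) / (m * k + K : ℕ)) ^ d) atTop (𝓝 (n * L * (m * (1 / m)) ^ d + (1 / m) ^ d)) :=
    (((hlim.const_mul _).pow d).const_mul _).add (hlim.pow d)
  have hle := le_of_tendsto_of_tendsto' hL hR fun k ↦ ?_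
  · rw [mul_one_div_cancel hm'.ne', one_pow, mul_one] at hle
    have : (0 : ℝ) < (1 / m) ^ d := by positivity
    linarith
  · have h1 : n * L * (m * k) ^ d + k ^ d ≤ n * (d ! * a (m * k + K)) := by
      calc n * L * (m * k) ^ d + k ^ d
          ≤ n * L * (d ! * (m * k + d).choose d) + d ! * (k + d).choose d := by
            gcongr <;> exact Nat.pow_le_factorial_mul_choose _ _
        _ = d ! * (n * L * (m * k + d).choose d + (k + d).choose d) := by ring
        _ ≤ d ! * (n * a (m * k + K)) := Nat.mul_le_mul_left _ (h k)
        _ = n * (d ! * a (m * k + K)) := by ring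
    have h2 : (n * L : ℝ) * (m * k) ^ d + k ^ d ≤ n * (d ! * a (m * k + K)) := by
      exact_mod_cast h1
    have h3 := div_le_div_of_nonneg_right h2
      (show (0 : ℝ) ≤ ((m * k + K : ℕ) : ℝ) ^ d by positivity)
    convert h3 using 1
    · rw [add_div, mul_pow, div_pow, mul_pow]
      ring
    · ring

/-! ### Presentations with syzygies in `I F` -/

/-- Lifting a basis of `N / I N` gives a presentation of `N` whose syzygies have entries in `I`. -/
theorem exists_surjective_ker_le_smul_top {R : Type*} [CommRing R] [IsLocalRing R] {I : Ideal R}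
    (hI : I ≤ IsLocalRing.maximalIdeal R)
    (N : Type*) [AddCommGroup N] [Module R N] [Module.Finite R N]
    (hN : Module.Free (R ⧸ I) (N ⧸ I • (⊤ : Submodule R N))) :
    ∃ (n : ℕ) (p : (Fin n → R) →ₗ[R] N), Function.Surjective p ∧ LinearMap.ker p ≤ I • ⊤ := by
  have : Nontrivial (R ⧸ I) :=
    Ideal.Quotient.nontrivial_iff.mpr (ne_top_of_le_ne_top Ideal.IsPrime.ne_top' hI)
  have : Module.Finite (R ⧸ I) (N ⧸ I • (⊤ : Submodule R N)) :=
    Module.Finite.of_restrictScalars_finite R _ _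
  let b := Module.finBasis (R ⧸ I) (N ⧸ I • (⊤ : Submodule R N))
  choose y hy using fun i ↦ Submodule.mkQ_surjective (I • (⊤ : Submodule R N)) (b i)
  let p := Fintype.linearCombination R y
  have hp : ∀ r, Submodule.mkQ (I • (⊤ : Submodule R N)) (p r) =
      ∑ i, Ideal.Quotient.mk I (r i) • b i := by
    intro r
    rw [Fintype.linearCombination_apply, map_sum]
    refine Finset.sum_congr rfl fun i _ ↦ ?_
    rw [map_smul, hy]
    rfl
  refine ⟨_, p, ?_, fun r hr ↦ ?_⟩
  · rw [← LinearMap.range_eq_top, ← top_le_iff]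
    refine Submodule.le_of_le_smul_of_le_jacobson_bot (I := I) Module.Finite.fg_top
      (hI.trans (IsLocalRing.maximalIdeal_le_jacobson _)) fun z _ ↦ ?_
    choose r hr using fun i ↦ Ideal.Quotient.mk_surjective (b.repr (Submodule.mkQ _ z) i)
    have h1 : Submodule.mkQ (I • (⊤ : Submodule R N)) (z - p r) = 0 := by
      rw [map_sub, hp, sub_eq_zero]
      conv_lhs => rw [← b.sum_repr (Submodule.mkQ _ z)]
      exact Finset.sum_congr rfl fun i _ ↦ by rw [hr]
    have h2 : z = p r + (z - p r) := by abel
    rw [h2]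
    exact Submodule.add_mem_sup ⟨r, rfl⟩ ((Submodule.Quotient.mk_eq_zero _).mp h1)
  · have h1 := hp r
    rw [LinearMap.mem_ker.mp hr, map_zero] at h1
    have h2 := Fintype.linearIndependent_iff.mp b.linearIndependent _ h1.symm
    rw [← Finset.univ_sum_single r]
    refine Submodule.sum_mem _ fun i _ ↦
      apply_mem_smul_top I (LinearMap.single R (fun _ ↦ R) i) ?_
    rw [Ideal.smul_top_eq_map, Algebra.algebraMap_self, Ideal.map_id]
    exact Ideal.Quotient.eq_zero_iff_mem.mp (h2 i)

theorem ker_lTensor_le_smul_top {R F M N : Type*} [CommRing R] [AddCommGroup F]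
    [Module R F] [AddCommGroup M] [Module R M] [AddCommGroup N] [Module R N] {I : Ideal R}
    {p : F →ₗ[R] N}
    (hp : Function.Surjective p) (hpI : LinearMap.ker p ≤ I • ⊤) :
    LinearMap.ker (p.lTensor M) ≤ I • ⊤ := by
  rw [LinearMap.exact_iff.mp (lTensor_exact M (LinearMap.exact_subtype_ker_map p) hp)]
  rintro _ ⟨w, rfl⟩
  induction w with
  | zero => simp
  | add a b ha hb =>
    rw [map_add]
    exact add_mem ha hb
  | tmul m l =>
    exact apply_mem_smul_top I (TensorProduct.mk R M F m) (hpI l.2)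

/-! ### Finiteness and dimension -/

section Local

variable {R : Type u} [CommRing R] [IsLocalRing R] [IsNoetherianRing R]

theorem length_quotient_smul_ne_top {J : Ideal R} (hJ : J.radical = IsLocalRing.maximalIdeal R)
    (M : Type*) [AddCommGroup M] [Module R M] [Module.Finite R M] :
    Module.length R (M ⧸ J • (⊤ : Submodule R M)) ≠ ⊤ := by
  have h1 : IsArtinianRing (R ⧸ J) := by
    refine IsLocalRing.quotient_artinian_of_mem_minimalPrimes_of_isLocalRing J ?_
    have : (IsLocalRing.maximalIdeal R).IsPrime := inferInstance
    rw [← Ideal.radical_minimalPrimes, hJ, Ideal.minimalPrimes_eq_subsingleton_self]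
    rfl
  have h2 : Module.Finite (R ⧸ J) (M ⧸ J • (⊤ : Submodule R M)) :=
    Module.Finite.of_restrictScalars_finite R _ _
  rw [Module.length_eq_of_surjective (R := R ⧸ J) Ideal.Quotient.mk_surjective]
  exact Module.length_ne_top

theorem supportDim_eq_natDim (M : Type*) [AddCommGroup M] [Module R M] [Nontrivial M] :
    Module.supportDim R M = UlrichMod.natDim R M := by
  have h1 : Module.supportDim R M ≠ ⊥ := Module.supportDim_ne_bot_of_nontrivial R M
  have h2 : Module.supportDim R M < ⊤ :=
    (Module.supportDim_le_ringKrullDim R M).trans_lt ringKrullDim_lt_top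
  obtain ⟨a, ha⟩ := WithBot.ne_bot_iff_exists.mp h1
  have h3 : a ≠ ⊤ := by
    rintro rfl
    rw [← ha] at h2
    exact h2.ne rfl
  lift a to ℕ using h3
  rw [UlrichMod.natDim, ← ha]
  rfl

/-- A Cohen-Macaulay module of dimension `d` admits a regular sequence of length `d`. -/
theorem exists_isRegular_of_isCohenMacaulay {R X : Type*} [CommRing R] [IsLocalRing R]
    [AddCommGroup X] [Module R X] [Nontrivial X] (hCM : UlrichMod.IsCohenMacaulay R X) {d : ℕ}
    (hd : Module.supportDim R X = d) : ∃ rs : List R, rs.length = d ∧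
      (∀ r ∈ rs, r ∈ IsLocalRing.maximalIdeal R) ∧ RingTheory.Sequence.IsRegular X rs := by
  have h1 : UlrichMod.depth R X = d := by
    rcases hCM with h | h
    · exact absurd h (not_subsingleton X)
    · rw [hd] at h
      exact_mod_cast h
  have : Nonempty {n : ℕ∞ | ∃ rs : List R, (∀ r ∈ rs, r ∈ IsLocalRing.maximalIdeal R) ∧
      RingTheory.Sequence.IsRegular X rs ∧ n = (rs.length : ℕ∞)} :=
    ⟨0, [], by simp, RingTheory.Sequence.IsRegular.nil R X, rfl⟩
  obtain ⟨rs, hrs, hreg, hlen⟩ := ENat.sSup_mem_of_nonempty_of_lt_top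
    (s := {n : ℕ∞ | ∃ rs : List R, (∀ r ∈ rs, r ∈ IsLocalRing.maximalIdeal R) ∧
      RingTheory.Sequence.IsRegular X rs ∧ n = (rs.length : ℕ∞)})
    (h1.trans_lt (ENat.natCast_lt_top d))
  refine ⟨rs, ?_, hrs, hreg⟩
  rw [show sSup _ = _ from h1] at hlen
  exact_mod_cast hlen.symm

/-! ### The kernel of `M ⊗ F → M ⊗ N` vanishes at the components of maximal dimension -/

/-- The comparison of multiplicities: since `M ⊗ N` is Cohen-Macaulay, its multiplicity is at least
`ℓ((M ⊗ N) / I (M ⊗ N)) = n * e(I, M)`, so the kernel of `M ⊗ R ^ n → M ⊗ N` has smaller dimension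
than `M`. -/
theorem exists_smul_eq_zero_of_mem_ker_lTensor {I : Ideal R}
    (hI : UlrichMod.IsMaximalPrimary R I) {M N : Type u} [AddCommGroup M] [Module R M]
    [Module.Finite R M] [AddCommGroup N] [Module R N] [Module.Finite R N] [Nontrivial M]
    (hCM : UlrichMod.IsCohenMacaulay R (M ⊗[R] N))
    (hdim : Module.supportDim R M = Module.supportDim R (M ⊗[R] N))
    (he : UlrichMod.HasMultiplicity R I M (UlrichMod.colength R I M : ℝ))
    {n : ℕ} {p : (Fin n → R) →ₗ[R] N} (hp : Function.Surjective p)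
    (hpI : LinearMap.ker p ≤ I • ⊤) (q : Ideal R) [q.IsPrime]
    (hq : ringKrullDim (R ⧸ q) = Module.supportDim R M) (w : M ⊗[R] (Fin n → R))
    (hw : p.lTensor M w = 0) : ∃ s ∉ q, s • w = 0 := by
  by_contra! hcon
  have hIm : I ≤ IsLocalRing.maximalIdeal R := hI ▸ Ideal.le_radical
  set d := UlrichMod.natDim R M with hd
  have hdM : Module.supportDim R M = d := supportDim_eq_natDim M
  have : Nontrivial (M ⊗[R] N) := by
    rw [← Module.supportDim_ne_bot_iff_nontrivial R, ← hdim]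
    exact Module.supportDim_ne_bot_of_nontrivial R M
  obtain ⟨rs, hlen, hrs, hreg⟩ := exists_isRegular_of_isCohenMacaulay hCM (hdim ▸ hdM)
  obtain ⟨K₁, hK₁⟩ := exists_length_mul_choose_le d R I hI (M ⊗[R] N) rs hlen hrs
    hreg.toIsWeaklyRegular
  obtain ⟨m, K₂, hm, hK₂⟩ := exists_choose_le_length_of_le_ringKrullDim hIm (d := d) q
    (by rw [hq, hdM])
  have hF (J : Ideal R) : Module.length R
      ((M ⊗[R] (Fin n → R)) ⧸ J • (⊤ : Submodule R (M ⊗[R] (Fin n → R)))) =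
        n * Module.length R (M ⧸ J • (⊤ : Submodule R M)) := by
    rw [length_quotient_smul_congr J (TensorProduct.piScalarRight R R M (Fin n)),
      length_pi_quotient_smul]
  have hv : Function.Surjective (p.lTensor M) := LinearMap.lTensor_surjective M hp
  have hX : n * Module.length R (M ⧸ I • (⊤ : Submodule R M)) ≤
      Module.length R ((M ⊗[R] N) ⧸ I • (⊤ : Submodule R (M ⊗[R] N))) := by
    rw [← hF]
    exact length_quotient_smul_le_of_ker_le _ hv (ker_lTensor_le_smul_top hp hpI)
  -- the cyclic module `R w` surjects onto `R / q`, which has dimension `d`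
  let τ := LinearMap.toSpanSingleton R (M ⊗[R] (Fin n → R)) w
  have hτ : LinearMap.ker τ ≤ q := by
    intro s hs
    by_contra hsq
    exact hcon s hsq hs
  let i : (R ⧸ LinearMap.ker τ) →ₗ[R] M ⊗[R] (Fin n → R) := (LinearMap.ker τ).liftQ τ le_rfl
  have hi : Function.Injective i := by
    rw [← LinearMap.ker_eq_bot]
    exact Submodule.ker_liftQ_eq_bot _ _ _ le_rfl
  have hiv : p.lTensor M ∘ₗ i = 0 := by
    ext
    change p.lTensor M ((1 : R) • w) = 0
    rw [one_smul, hw]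
  obtain ⟨c, hc⟩ := exists_mem_pow_smul_of_injective I i hi
  have key (k : ℕ) : n * Module.length R (M ⧸ I • (⊤ : Submodule R M)) *
      ((m * k + d).choose d : ℕ) + ((k + d).choose d : ℕ) ≤
      n * Module.length R (M ⧸ I ^ (m * k + (K₁ + K₂ + c + 1)) • (⊤ : Submodule R M)) := by
    have h1 := length_add_length_le (I ^ (m * k + (K₁ + K₂ + 1) + c))
      (I ^ (m * k + (K₁ + K₂ + 1))) i (p.lTensor M) hv hiv (hc _)
    rw [hF] at h1
    have e1 : m * k + (K₁ + K₂ + 1) + c = m * k + (K₁ + K₂ + c + 1) := by ring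
    rw [e1, add_comm] at h1
    refine le_trans (add_le_add ?_ ?_) h1
    · refine (mul_le_mul_left hX _).trans ((hK₁ (m * k)).trans ?_)
      exact length_quotient_pow_smul_monotone I (by lia)
    · refine (hK₂ k).trans (le_trans ?_ (length_quotient_smul_le_of_surjective _
        (Submodule.factor hτ) (Submodule.factor_surjective _)))
      exact length_quotient_pow_smul_monotone I (by lia)
  have hfin (j : ℕ) : (UlrichMod.colength R (I ^ (j + 1)) M : ℕ∞) =
      Module.length R (M ⧸ I ^ (j + 1) • (⊤ : Submodule R M)) :=
    ENat.natCast_toNat (length_quotient_smul_ne_top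
      ((Ideal.radical_pow I (Nat.succ_ne_zero j)).trans hI) M)
  refine not_forall_choose_add_choose_le (n := n) (K := K₁ + K₂ + c + 1) hm he fun k ↦ ?_
  have h1 := key k
  have h2 := hfin 0
  rw [zero_add, pow_one] at h2
  rw [← add_assoc, ← hfin, ← h2] at h1
  exact_mod_cast h1

end Local

/-! ### Vanishing of a submodule, tested at primes -/

section Support

variable {R : Type u} [CommRing R]

theorem exists_notMem_smul_pi_eq_zero {M ι : Type*} [AddCommGroup M] [Module R M] [Finite ι]
    {q : Ideal R} [q.IsPrime] {v : ι → M} (hv : ∀ i, ∃ s ∉ q, s • v i = 0) :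
    ∃ s ∉ q, s • v = 0 := by
  have := Fintype.ofFinite ι
  choose s hs hsv using hv
  refine ⟨∏ i, s i, ?_, funext fun i ↦ ?_⟩
  · rw [Ideal.IsPrime.prod_mem_iff]
    simpa using hs
  · obtain ⟨c, hc⟩ := Finset.dvd_prod_of_mem s (Finset.mem_univ i)
    rw [Pi.smul_apply, hc, mul_comm, mul_smul, hsv, smul_zero, Pi.zero_apply]

/-- A tuple of elements of `M` which vanishes locally at every associated prime of `M` is zero. -/
theorem pi_eq_zero_of_forall_associatedPrimes [IsNoetherianRing R] {M ι : Type*} [AddCommGroup M]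
    [Module R M] {v : ι → M} (hv : ∀ q ∈ associatedPrimes R M, ∃ s ∉ q, s • v = 0) : v = 0 := by
  by_contra hne
  obtain ⟨i, hi⟩ := Function.ne_iff.mp hne
  obtain ⟨q, hq, hle⟩ := exists_le_isAssociatedPrime_of_isNoetherianRing R (v i) hi
  obtain ⟨s, hs, hsv⟩ := hv q hq
  refine hs (hle ?_)
  rw [Submodule.mem_colon_singleton]
  exact congrFun hsv i

/-- If `M_q ≠ 0`, then `(M ⊗ L)_q = 0` forces `L_q = 0`, for finitely generated `M` and `L`. -/
theorem exists_notMem_smul_eq_zero_of_tensorProduct {M L : Type u} [AddCommGroup M] [Module R M]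
    [Module.Finite R M] [AddCommGroup L] [Module R L] [Module.Finite R L] {q : PrimeSpectrum R}
    (hM : q ∈ Module.support R M) (h : ∀ w : M ⊗[R] L, ∃ s ∉ q.asIdeal, s • w = 0) (l : L) :
    ∃ s ∉ q.asIdeal, s • l = 0 := by
  have key {X : Type u} [AddCommGroup X] [Module R X] [Module.Finite R X]
      (hX : q ∈ Module.support R X) :
      ∃ (f : X →ₗ[R] q.asIdeal.ResidueField) (x : X), f x ≠ 0 := by
    rw [Module.mem_support_iff_nontrivial_residueField_tensorProduct] at hX
    by_contra! hf
    obtain ⟨g, hg⟩ := exists_ne (0 : Module.Dual q.asIdeal.ResidueField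
      (q.asIdeal.ResidueField ⊗[R] X))
    refine hg (TensorProduct.AlgebraTensorModule.ext fun a x ↦ ?_)
    have h1 : g ((1 : q.asIdeal.ResidueField) ⊗ₜ[R] x) = 0 :=
      hf (g.restrictScalars R ∘ₗ TensorProduct.mk R q.asIdeal.ResidueField X 1) x
    have h2 : a ⊗ₜ[R] x = a • ((1 : q.asIdeal.ResidueField) ⊗ₜ[R] x) := by
      rw [TensorProduct.smul_tmul', smul_eq_mul, mul_one]
    rw [h2, map_smul, h1, smul_zero, LinearMap.zero_apply]
  revert l
  rw [← Module.notMem_support_iff']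
  intro hL
  obtain ⟨f, m, hm⟩ := key hM
  obtain ⟨g, l, hl⟩ := key hL
  obtain ⟨s, hs, hsw⟩ := h (m ⊗ₜ l)
  have h1 := congrArg (LinearMap.mul' R q.asIdeal.ResidueField ∘ₗ TensorProduct.map f g) hsw
  rw [map_smul, map_zero, LinearMap.comp_apply, TensorProduct.map_tmul, LinearMap.mul'_apply,
    Algebra.smul_def, mul_eq_zero, or_iff_left (mul_ne_zero hm hl),
    Ideal.algebraMap_residueField_eq_zero] at h1
  exact hs h1

end Support

/-! ### Modules with rank -/

section Rank

variable {R : Type u} [CommRing R] {N : Type u} [AddCommGroup N] [Module R N]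

theorem localizedModule_map_injective_iff {S : Submonoid R} {F : Type*} [AddCommGroup F]
    [Module R F] (p : F →ₗ[R] N) :
    Function.Injective (LocalizedModule.map S p) ↔ ∀ l ∈ LinearMap.ker p, ∃ s ∈ S, s • l = 0 := by
  rw [injective_iff_map_eq_zero]
  constructor
  · intro h l hl
    have h1 := h (LocalizedModule.mk l 1) (by
      rw [LocalizedModule.map_mk, LinearMap.mem_ker.mp hl, LocalizedModule.zero_mk])
    rw [← LocalizedModule.mkLinearMap_apply, IsLocalizedModule.eq_zero_iff S] at h1
    obtain ⟨s, hs⟩ := h1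
    exact ⟨s, s.2, hs⟩
  · intro h x hx
    induction x using LocalizedModule.induction_on with | _ x t
    rw [LocalizedModule.map_mk, ← LocalizedModule.zero_mk 1, LocalizedModule.mk_eq] at hx
    obtain ⟨a, ha⟩ := hx
    obtain ⟨s, hs, hsl⟩ := h (a • x) (by simpa using ha)
    rw [← LocalizedModule.zero_mk 1, LocalizedModule.mk_eq]
    refine ⟨⟨s, hs⟩ * a, ?_⟩
    rw [one_smul, smul_zero, smul_zero, mul_smul]
    exact hsl

/-- If `N` has rank and a surjection `R ^ n → N` becomes injective at one prime, then it becomes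
injective at every associated prime of `R`: below the given prime there is a minimal prime, which
is associated and shows that the rank of `N` is `n`, and a surjection between free modules of
rank `n` is injective. -/
theorem exists_notMem_smul_eq_zero_of_hasRank [IsNoetherianRing R] {r : ℕ}
    (hr : UlrichMod.HasRank R N r) {n : ℕ} {p : (Fin n → R) →ₗ[R] N} (hp : Function.Surjective p)
    {q₀ : Ideal R} [q₀.IsPrime] (h : ∀ l ∈ LinearMap.ker p, ∃ s ∉ q₀, s • l = 0)
    {q : Ideal R} [q.IsPrime] (hq : q ∈ associatedPrimes R R) :
    ∀ l ∈ LinearMap.ker p, ∃ s ∉ q, s • l = 0 := by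
  let e (q : Ideal R) [q.IsPrime] : LocalizedModule q.primeCompl (Fin n → R)
      ≃ₗ[Localization.AtPrime q] (Fin n → Localization.AtPrime q) :=
    ((Pi.basisFun R (Fin n)).ofIsLocalizedModule (Localization.AtPrime q) q.primeCompl
      (LocalizedModule.mkLinearMap q.primeCompl (Fin n → R))).equivFun
  have hnr : n = r := by
    obtain ⟨q₁, hq₁, hle⟩ := Ideal.exists_minimalPrimes_le (bot_le : ⊥ ≤ q₀)
    have := hq₁.1.1
    have hass : q₁ ∈ associatedPrimes R R :=
      Module.associatedPrimes.minimalPrimes_annihilator_subset_associatedPrimes R R (by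
        rwa [Module.annihilator_eq_bot.mpr inferInstance])
    obtain ⟨g⟩ := hr q₁ hass
    have hinj : Function.Injective (LocalizedModule.map q₁.primeCompl p) := by
      rw [localizedModule_map_injective_iff]
      intro l hl
      obtain ⟨s, hs, hsl⟩ := h l hl
      exact ⟨s, fun hmem ↦ hs (hle hmem), hsl⟩
    have E := (e q₁).symm ≪≫ₗ LinearEquiv.ofBijective _
      ⟨hinj, LocalizedModule.map_surjective q₁.primeCompl p hp⟩ ≪≫ₗ g
    simpa using E.finrank_eq
  subst hnr
  obtain ⟨g⟩ := hr q hq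
  have := Module.Finite.equiv (e q).symm
  have := Module.Finite.equiv g.symm
  refine (localizedModule_map_injective_iff (S := q.primeCompl) p).mp ?_
  exact OrzechProperty.injective_of_surjective_of_injective (e q ≪≫ₗ g.symm).toLinearMap _
    (e q ≪≫ₗ g.symm).injective (LocalizedModule.map_surjective q.primeCompl p hp)

/-- A module of positive rank contains, locally at an associated prime of `R`, an element with zero
annihilator. -/
theorem exists_forall_smul_eq_zero_of_hasRank {r : ℕ} (hr : UlrichMod.HasRank R N r) (h0 : 0 < r)
    {q : Ideal R} [q.IsPrime] (hq : q ∈ associatedPrimes R R) :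
    ∃ m : N, ∀ a : R, a • m = 0 → ∃ s ∉ q, s * a = 0 := by
  obtain ⟨e⟩ := hr q hq
  obtain ⟨⟨m, t⟩, hmt⟩ := IsLocalizedModule.mk'_surjective q.primeCompl
    (LocalizedModule.mkLinearMap q.primeCompl N) (e.symm (Pi.single ⟨0, h0⟩ 1))
  refine ⟨m, fun a ha ↦ ?_⟩
  rw [Function.uncurry_apply_pair, IsLocalizedModule.mk'_eq_iff] at hmt
  have h1 := congrArg (fun x ↦ e (a • x)) hmt
  simp only [← map_smul, ha, map_zero] at h1
  have h2 : e (a • t • e.symm (Pi.single ⟨0, h0⟩ 1)) = algebraMap R (Localization.AtPrime q) (a * t)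
      • (Pi.single ⟨0, h0⟩ 1 : Fin r → Localization.AtPrime q) := by
    rw [Submonoid.smul_def, smul_smul, ← algebraMap_smul (Localization.AtPrime q), map_smul,
      e.apply_symm_apply]
  rw [h2] at h1
  have h3 := congrFun h1 ⟨0, h0⟩
  rw [Pi.smul_apply, Pi.single_eq_same, smul_eq_mul, mul_one, Pi.zero_apply, eq_comm,
    IsLocalization.map_eq_zero_iff q.primeCompl] at h3
  obtain ⟨c, hc⟩ := h3
  refine ⟨c * t, (c * t).2, ?_⟩
  rw [← hc]
  ring

end Rank

/-! ### Freeness -/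

section Free

variable {R : Type u} [CommRing R]

/-- A surjection `R ^ n → N` is an isomorphism as soon as its kernel vanishes at the associated
primes of `R`. -/
theorem Module.Free.of_forall_associatedPrimes [IsNoetherianRing R] {N : Type u} [AddCommGroup N]
    [Module R N] {n : ℕ} {p : (Fin n → R) →ₗ[R] N} (hp : Function.Surjective p)
    (h : ∀ q ∈ associatedPrimes R R, ∀ l ∈ LinearMap.ker p, ∃ s ∉ q, s • l = 0) :
    Module.Free R N := by
  refine Module.Free.of_equiv (LinearEquiv.ofBijective p ⟨?_, hp⟩)
  rw [← LinearMap.ker_eq_bot, eq_bot_iff]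
  exact fun l hl ↦ pi_eq_zero_of_forall_associatedPrimes fun q hq ↦ h q hq l hl

variable {M N : Type u} [AddCommGroup M] [Module R M] [AddCommGroup N] [Module R N]
  {n : ℕ} {p : (Fin n → R) →ₗ[R] N}

theorem lTensor_tmul_eq_zero (m : M) {l : Fin n → R} (hl : l ∈ LinearMap.ker p) :
    p.lTensor M (m ⊗ₜ l) = 0 := by
  rw [LinearMap.lTensor_tmul, LinearMap.mem_ker.mp hl, TensorProduct.tmul_zero]

theorem smul_smul_eq_zero_of_smul_tmul_eq_zero {s : R} {m : M} {l : Fin n → R}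
    (h : s • (m ⊗ₜ[R] l) = 0) (i : Fin n) : (s * l i) • m = 0 := by
  have h1 : TensorProduct.piScalarRight R R M (Fin n) (s • (m ⊗ₜ[R] l)) i = 0 := by
    rw [h, map_zero, Pi.zero_apply]
  rw [map_smul] at h1
  simpa [mul_smul] using h1

theorem eq_zero_of_forall_associatedPrimes_smul_eq_zero [IsNoetherianRing R]
    {w : M ⊗[R] (Fin n → R)} (hw : ∀ q ∈ associatedPrimes R M, ∃ s ∉ q, s • w = 0) : w = 0 := by
  rw [← LinearEquiv.map_eq_zero_iff (TensorProduct.piScalarRight R R M (Fin n))]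
  refine pi_eq_zero_of_forall_associatedPrimes (R := R) fun q hq ↦ ?_
  obtain ⟨s, hs, hsw⟩ := hw q hq
  exact ⟨s, hs, by rw [← map_smul, hsw, map_zero]⟩

end Free

section Main

variable {R : Type u} [CommRing R] [IsNoetherianRing R] {M N : Type u}
  [AddCommGroup M] [Module R M] [Module.Finite R M] [AddCommGroup N] [Module R N]
  {n : ℕ} {p : (Fin n → R) →ₗ[R] N}

/-- If `N` has rank and `Tor₁(M, N)` vanishes at a component `q₀` of `M` of maximal dimension, then
the syzygy `L` of `N` satisfies `(M ⊗ L)_{q₀} = 0`, hence `L_{q₀} = 0`, and the rank of `N`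
carries this over to the associated primes of `R`. -/
theorem free_of_hasRank (hp : Function.Surjective p) {r : ℕ} (hr : UlrichMod.HasRank R N r)
    {q₀ : Ideal R} [q₀.IsPrime] (hq₀ : q₀ ∈ associatedPrimes R M)
    (hker : ∀ w : M ⊗[R] (Fin n → R), p.lTensor M w = 0 → ∃ s ∉ q₀, s • w = 0)
    (hT : ∀ t : UlrichMod.Tor1 R M N, ∃ s ∈ q₀.primeCompl, s • t = 0) : Module.Free R N := by
  refine Module.Free.of_forall_associatedPrimes hp fun q hq ↦ ?_
  have := hq.isPrime
  refine exists_notMem_smul_eq_zero_of_hasRank hr hp (q₀ := q₀) (fun l hl ↦ ?_) hq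
  have hsupp : (⟨q₀, inferInstance⟩ : PrimeSpectrum R) ∈ Module.support R M := by
    rw [Module.mem_support_iff_of_finite]
    exact Submodule.annihilator_top (R := R) (M := M) ▸ hq₀.annihilator_le
  suffices hw : ∀ w : M ⊗[R] LinearMap.ker p, ∃ s ∉ q₀, s • w = 0 by
    obtain ⟨s, hs, hsl⟩ := exists_notMem_smul_eq_zero_of_tensorProduct hsupp hw ⟨l, hl⟩
    exact ⟨s, hs, congrArg Subtype.val hsl⟩
  intro w
  obtain ⟨s, hs, hsw⟩ := hker ((LinearMap.ker p).subtype.lTensor M w) (by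
    rw [← LinearMap.comp_apply, ← LinearMap.lTensor_comp, LinearMap.comp_ker_subtype,
      LinearMap.lTensor_zero, LinearMap.zero_apply])
  obtain ⟨t, ht, htw⟩ := exists_smul_eq_zero_of_Tor1 hT hp (s • w) (by rw [map_smul, hsw])
  exact ⟨t * s, fun hmem ↦ (Ideal.IsPrime.mem_or_mem ‹_› hmem).elim ht hs,
    by rw [mul_smul, htw]⟩

/-- If `M ⊗ R ^ n → M ⊗ N` is injective, then `M ⊗ L` is a quotient of `Tor₁(M, N)`, where `L` is
the syzygy of `N`; so `L` vanishes at every prime of the support of `M` at which `Tor₁(M, N)` is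
killed by `T`. -/
theorem exists_notMem_smul_eq_zero_of_Tor1 (hp : Function.Surjective p)
    (hker : ∀ w : M ⊗[R] (Fin n → R), p.lTensor M w = 0 → w = 0) {T : Submonoid R}
    (hT : ∀ t : UlrichMod.Tor1 R M N, ∃ s ∈ T, s • t = 0) {q : PrimeSpectrum R}
    (hq : q ∈ Module.support R M) (hTq : ∀ s ∈ T, s ∉ q.asIdeal) {l : Fin n → R}
    (hl : l ∈ LinearMap.ker p) : ∃ s ∉ q.asIdeal, s • l = 0 := by
  suffices hw : ∀ w : M ⊗[R] LinearMap.ker p, ∃ s ∉ q.asIdeal, s • w = 0 by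
    obtain ⟨s, hs, hsl⟩ := exists_notMem_smul_eq_zero_of_tensorProduct hq hw ⟨l, hl⟩
    exact ⟨s, hs, congrArg Subtype.val hsl⟩
  intro w
  obtain ⟨t, ht, htw⟩ := exists_smul_eq_zero_of_Tor1 hT hp w (hker _ (by
    rw [← LinearMap.comp_apply, ← LinearMap.lTensor_comp, LinearMap.comp_ker_subtype,
      LinearMap.lTensor_zero, LinearMap.zero_apply]))
  exact ⟨t, hTq t ht, htw⟩

/-- The case of injective `M ⊗ R ^ n → M ⊗ N`, which arises when `M` is unmixed. -/
theorem free_of_lTensor_injective [IsLocalRing R] [Nontrivial M] (hp : Function.Surjective p)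
    (hker : ∀ w : M ⊗[R] (Fin n → R), p.lTensor M w = 0 → w = 0)
    (h : Module.annihilator R M = ⊥ ∨ Subsingleton (UlrichMod.Tor1 R M N) ∨
      (Module.IsTorsion R (UlrichMod.Tor1 R M N) ∧ Module.support R M = Set.univ)) :
    Module.Free R N := by
  refine Module.Free.of_forall_associatedPrimes hp fun q hq l hl ↦ ?_
  have := hq.isPrime
  rcases h with h | h | ⟨h, hsupp⟩
  · have h0 : l = 0 := by
      funext i
      rw [Pi.zero_apply, ← Ideal.mem_bot, ← h, Module.mem_annihilator]
      intro m
      simpa using smul_smul_eq_zero_of_smul_tmul_eq_zero (s := 1) (m := m) (l := l)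
        (by rw [hker _ (lTensor_tmul_eq_zero m hl), smul_zero]) i
    exact ⟨1, q.one_notMem, by rw [h0, smul_zero]⟩
  · -- the maximal ideal lies in the support of `M`, and elements outside of it are units
    obtain ⟨s, hs, hsl⟩ := exists_notMem_smul_eq_zero_of_Tor1 (T := ⊥) hp hker
      (fun t ↦ ⟨1, one_mem _, Subsingleton.elim _ _⟩) (IsLocalRing.closedPoint_mem_support R M)
      (fun s hs ↦ by
        rw [Submonoid.mem_bot.mp hs]
        exact Ideal.one_notMem _) hl
    have hu : IsUnit s := IsLocalRing.notMem_maximalIdeal.mp hs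
    exact ⟨s, fun hmem ↦ Ideal.IsPrime.ne_top ‹_› (q.eq_top_of_isUnit_mem hmem hu), hsl⟩
  · refine exists_notMem_smul_eq_zero_of_Tor1 (T := nonZeroDivisors R) hp hker (fun t ↦ ?_)
      (q := ⟨q, inferInstance⟩) (hsupp ▸ Set.mem_univ _) (fun s hs hsq ↦ ?_) hl
    · obtain ⟨a, ha⟩ := @h t
      exact ⟨a, a.2, ha⟩
    · have h1 : s ∈ ⋃ q ∈ associatedPrimes R R, (q : Set R) := Set.mem_biUnion hq hsq
      rw [biUnion_associatedPrimes_eq_compl_nonZeroDivisors] at h1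
      exact h1 hs

/-- A module of positive rank is supported at every associated prime of `R`, so at the primes `q` in
`Assh(R)` one has `dim R / q ≤ dim M ≤ dim R = dim R / q`. -/
theorem supportDim_eq_of_hasRank {R M : Type u} [CommRing R] [AddCommGroup M] [Module R M]
    [Module.Finite R M] {r : ℕ} (hr : UlrichMod.HasRank R M r) (h0 : 0 < r)
    {q : Ideal R} [q.IsPrime] (hq : q ∈ UlrichMod.assh R R) :
    ringKrullDim (R ⧸ q) = Module.supportDim R M := by
  obtain ⟨m, hm⟩ := exists_forall_smul_eq_zero_of_hasRank hr h0 hq.1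
  have hle : Module.annihilator R M ≤ q := by
    intro a ha
    obtain ⟨s, hs, hsa⟩ := hm a (Module.mem_annihilator.mp ha m)
    exact (Ideal.IsPrime.mem_or_mem ‹_› (hsa ▸ q.zero_mem : s * a ∈ q)).resolve_left hs
  refine le_antisymm ?_ ?_
  · rw [Module.supportDim_eq_ringKrullDim_quotient_annihilator]
    exact ringKrullDim_le_of_surjective (Ideal.Quotient.factor hle)
      (Ideal.Quotient.factor_surjective hle)
  · rw [hq.2, Module.supportDim_self_eq_ringKrullDim]
    exact Module.supportDim_le_ringKrullDim R M

/-- At an associated prime `q` of `R` the module `M` has an element `m` with zero annihilator in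
`R_q`. The elements `m ⊗ l`, for `l` in the syzygy of `N`, vanish at `q`, hence so does the
syzygy. -/
theorem free_of_hasRank_of_isUnmixed_self (hp : Function.Surjective p) {r : ℕ}
    (hr : UlrichMod.HasRank R M r) (h0 : 0 < r) (hR : UlrichMod.IsUnmixed R R)
    (hker : ∀ (q : Ideal R) [q.IsPrime], ringKrullDim (R ⧸ q) = Module.supportDim R M →
      ∀ w : M ⊗[R] (Fin n → R), p.lTensor M w = 0 → ∃ s ∉ q, s • w = 0) : Module.Free R N := by
  refine Module.Free.of_forall_associatedPrimes hp fun q hq l hl ↦ ?_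
  have := hq.isPrime
  obtain ⟨m, hm⟩ := exists_forall_smul_eq_zero_of_hasRank hr h0 hq
  obtain ⟨s, hs, hsw⟩ := hker q (supportDim_eq_of_hasRank hr h0 (hR ▸ hq)) (m ⊗ₜ l)
    (lTensor_tmul_eq_zero m hl)
  refine exists_notMem_smul_pi_eq_zero fun i ↦ ?_
  obtain ⟨t, ht, hti⟩ := hm _ (smul_smul_eq_zero_of_smul_tmul_eq_zero hsw i)
  exact ⟨t * s, fun hmem ↦ (Ideal.IsPrime.mem_or_mem ‹_› hmem).elim ht hs,
    by rw [smul_eq_mul, mul_assoc, hti]⟩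

end Main

theorem mainTheorem2 (R : Type u) [CommRing R] [IsLocalRing R] [IsNoetherianRing R]
    (I : Ideal R) (hI : UlrichMod.IsMaximalPrimary R I)
    (M N : Type u) [AddCommGroup M] [Module R M] [Module.Finite R M]
    [AddCommGroup N] [Module R N] [Module.Finite R N]
    (hM : Nontrivial M)
    (hMI : Module.Free (R ⧸ I) (M ⧸ (I • (⊤ : Submodule R M))))
    (hNI : Module.Free (R ⧸ I) (N ⧸ (I • (⊤ : Submodule R N))))
    (hCM : UlrichMod.IsCohenMacaulay R (M ⊗[R] N))
    (hdim : Module.supportDim R M = Module.supportDim R (M ⊗[R] N))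
    (he : UlrichMod.HasMultiplicity R I M (UlrichMod.colength R I M : ℝ))
    (h :
      ((∃ r : ℕ, UlrichMod.HasRank R N r) ∧
        ∃ (p : Ideal R) (_ : p.IsPrime), p ∈ UlrichMod.assh R M ∧
          Subsingleton (LocalizedModule p.primeCompl (UlrichMod.Tor1 R M N))) ∨
      (UlrichMod.IsUnmixed R M ∧
        (Module.annihilator R M = ⊥ ∨
          Subsingleton (UlrichMod.Tor1 R M N) ∨
          (Module.IsTorsion R (UlrichMod.Tor1 R M N) ∧ Module.support R M = Set.univ))) ∨
      ((∃ r : ℕ, 0 < r ∧ UlrichMod.HasRank R M r) ∧ UlrichMod.IsUnmixed R R)) :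
    Module.Free R N := by
  obtain ⟨n, p, hp, hpI⟩ := exists_surjective_ker_le_smul_top (hI ▸ Ideal.le_radical) N hNI
  have hker (q : Ideal R) [q.IsPrime] (hq : ringKrullDim (R ⧸ q) = Module.supportDim R M)
      (w : M ⊗[R] (Fin n → R)) (hw : p.lTensor M w = 0) : ∃ s ∉ q, s • w = 0 :=
    exists_smul_eq_zero_of_mem_ker_lTensor hI hCM hdim he hp hpI q hq w hw
  rcases h with ⟨⟨r, hr⟩, q, hq, hass, hT⟩ | ⟨hunm, h⟩ | ⟨⟨r, h0, hr⟩, hR⟩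
  · rw [LocalizedModule.subsingleton_iff] at hT
    exact free_of_hasRank hp hr hass.1 (hker q hass.2) hT
  · refine free_of_lTensor_injective hp (fun w hw ↦ ?_) h
    refine eq_zero_of_forall_associatedPrimes_smul_eq_zero fun q hq ↦ ?_
    have := hq.isPrime
    have hq' : q ∈ UlrichMod.assh R M := hunm ▸ hq
    exact hker q hq'.2 w hw
  · exact free_of_hasRank_of_isUnmixed_self hp hr h0 hR hker
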